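/- There are an exponent $K_0\in\mathbb N$, constants $K\in\mathbb N$ and $c>0$, and a fixed program $P$ of a unit-cost random access machine (with addition and truncated subtraction, and one external subroutine) such that for all $K_1\ge K_0$ and $\alpha>0$ there is $c'>0$ (depending only on $K_1$ and $\alpha$) with the following property. Let $\mathbb F_q=\{0,1,\dots,q-1\}$ be any finite field (its elements labelled by $0,\dots,q-1$, with $0$ labelled $0$), let $\kappa_C\ge 1$, and let $C:\mathbb F_q^m\to\mathbb F_q^{n_C}$ be a linear map whose values at distinct messages have Hamming distance at least $2\kappa_C+1$; let $D:\mathbb F_q^{n_C}\to\mathbb F_q^m$ be a decoder that corrects $\kappa_C$ Hamming errors, computed by a subroutine in $T$ steps. Let $a$ be an integer with $(n_C/\kappa_C)^{K_0}\le a\le (n_C/\kappa_C)^{K_1}$. For run lengths $S=(S_1,\dots,S_{n_C})$ and $x\in\mathbb F_q^m$, with $y=C(x)$, put $$\mathrm{Enc}_S(x)=0^{S_1}\,y_1\,0^{S_2}\,y_2\cdots 0^{S_{n_C}}\,y_{n_C}\in\mathbb F_q^{n},\qquad n=n_C+\sum_i S_i .$$ Let $\kappa=\lfloor 0.01\,\kappa_C\rfloor$.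 The edit distance is the least number of insertions and deletions transforming one string into the other. Let $z'$ be a string over $\mathbb F_q$, let $p_i=\sum_{k\le i}(S_k+1)$ be the position of the $i$-th blank in the template $0^{S_1}?\,0^{S_2}?\cdots 0^{S_{n_C}}?$, and let $q_j$ be the position of the $j$-th non-zero symbol of $z'$. A matching is a sequence $w=((i_1,j_1),\dots,(i_r,j_r))$, strictly increasing in both entries, of pairs of a blank $i$ and a non-zero symbol $j$ of $z'$; $|w|=r$, and $\mathrm{cost}(w)$ is the number of $k\le r$ with $p_{i_k}-p_{i_{k-1}}\ne q_{j_k}-q_{j_{k-1}}$, where $p_{i_0}=q_{j_0}=0$. Filling each matched blank with the symbol matched to it and every other blank with $0$ gives a word $y'(w)\in\mathbb F_q^{n_C}$. Then there are maps $\mathrm{Dec}_S$ from strings over $\mathbb F_q$ to $\mathbb F_q^m$, one for every $S$, such that: 1. For all $S$ and $z'$ one has $\mathrm{Dec}_S(z')=D(y'(w))$ for some matching $w$ that maximizes $|w|-\mathrm{cost}(w)$, and $P$, given $S$ and $z'$, outputs $\mathrm{Dec}_S(z')$ in at most $K(n+|z'|+1)^4+T$ steps. 2. If $S_1,\dots,S_{n_C}$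 are independent and uniform on $\{1,\dots,a\}$, then with failure probability at most $2^{-c\kappa_C}$ the map $\mathrm{Enc}_S$ is a linear $(n,m,2\kappa+1)$ code for the edit distance (a linear map $\mathbb F_q^m\to\mathbb F_q^n$ whose values at distinct messages have edit distance at least $2\kappa+1$) and $\mathrm{Dec}_S$ corrects $\kappa$ insertions and deletions: $\mathrm{Dec}_S(z')=x$ for all $x$ and all strings $z'$ of edit distance at most $\kappa$ from $\mathrm{Enc}_S(x)$. 3. With failure probability at most $2^{-c'\kappa_C}+2^{-c\,\alpha\, a\, n_C}$ all of (2) holds and, moreover, $$n\in\Big[(1-\alpha)\tfrac{n_C(a+1)}2+n_C,\ (1+\alpha)\tfrac{n_C(a+1)}2+n_C\Big].$$ -/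

import Mathlib

open MeasureTheory

namespace InsdelCode

/-! ## Edit distance (insertions and deletions) and linear insdel codes -/

/-- `EditSteps k x y`: the string `x` can be transformed into `y` by exactly `k` operations, each of
which inserts or deletes one symbol. -/
inductive EditSteps {σ : Type*} : ℕ → List σ → List σ → Prop
  | refl (x : List σ) : EditSteps 0 x x
  | insert {k : ℕ} {x u v : List σ} (s : σ) :
      EditSteps k x (u ++ v) → EditSteps (k + 1) x (u ++ s :: v)
  | delete {k : ℕ} {x u v : List σ} (s : σ) :
      EditSteps k x (u ++ s :: v) → EditSteps (k + 1) x (u ++ v)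

/-- The edit distance: the least number of insertions and deletions that transform `x` into `y`. -/
noncomputable def editDist {σ : Type*} (x y : List σ) : ℕ := sInf {k | EditSteps k x y}

/-- `enc` is (the encoding map of) a linear `(n, m, d)` code for the edit distance over `F`: it is a
linear map from `F ^ m` to `F ^ n`, the words of `F ^ n` being read as strings of length `n`, and the
encodings of distinct messages have edit distance at least `d`. -/
def IsLinearInsdelCode {F : Type*} [Field F] {m : ℕ} (n d : ℕ) (enc : (Fin m → F) → List F) : Prop :=
  (∃ L : (Fin m → F) →ₗ[F] (Fin n → F), ∀ x, enc x = List.ofFn (L x)) ∧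
    ∀ x x' : Fin m → F, x ≠ x' → d ≤ editDist (enc x) (enc x')

/-- The decoding map `dec` corrects `k` insertions and deletions. -/
def CorrectsInsdels {F : Type*} {m : ℕ} (k : ℕ) (enc : (Fin m → F) → List F)
    (dec : List F → Fin m → F) : Prop :=
  ∀ (x : Fin m → F) (z : List F), editDist (enc x) z ≤ k → dec z = x

/-! ## The encoding -/

/-- The string `0^{S 0} ∘ y 0 ∘ 0^{S 1} ∘ y 1 ∘ ⋯`: before each symbol of `y` a run of zeros is
inserted, `S i` being the length of the `i`-th run. -/
def interleave {F : Type*} [Zero F] {N : ℕ} (S : Fin N → ℕ) (y : Fin N → F) : List F :=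
  (List.ofFn fun i => List.replicate (S i) 0 ++ [y i]).flatten

/-- The length of all strings `interleave S y`. -/
def blockLength {N : ℕ} (S : Fin N → ℕ) : ℕ := N + ∑ i, S i

/-- The law of the sequence of run lengths: `N` independent random variables, each uniformly
distributed on `{1, …, a}`. -/
noncomputable def runLaw (N a : ℕ) : Measure (Fin N → ℕ) :=
  Measure.pi fun _ => ProbabilityTheory.uniformOn (Set.Icc 1 a)

/-! ## Matchings of blanks to non-zero symbols -/

/-- The position (counted from `1`) of the `i`-th blank in the template
`0^{S 0} ∘ ? ∘ 0^{S 1} ∘ ? ∘ ⋯`. -/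
def blankPos {N : ℕ} (S : Fin N → ℕ) (i : Fin N) : ℕ := ∑ k ∈ Finset.Iic i, (S k + 1)

/-- A monotone matching of blanks to non-zero symbols of `z`, listed in increasing order. The pair
`(i, t)` matches the `i`-th blank to the symbol of `z` with index `t` (counted from `0`). -/
def IsMatching {F : Type*} [Zero F] {N : ℕ} (z : List F) (w : List (Fin N × Fin z.length)) : Prop :=
  w.Pairwise (fun b b' => b.1 < b'.1 ∧ b.2 < b'.2) ∧ ∀ b ∈ w, z.get b.2 ≠ 0

/-- The cost of a matching whose first entry is preceded by a match of position `p` of the template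
to position `q` of the received word. -/
def costFrom {N l : ℕ} (S : Fin N → ℕ) : ℕ → ℕ → List (Fin N × Fin l) → ℕ
  | _, _, [] => 0
  | p, q, b :: w =>
      (if (blankPos S b.1 : ℤ) - p = ((b.2 : ℕ) + 1 : ℤ) - q then 0 else 1) +
        costFrom S (blankPos S b.1) ((b.2 : ℕ) + 1) w

/-- The number of matches whose distance to the preceding match differs in the two strings; the first
match is compared with position `0` in both strings. -/
def cost {N l : ℕ} (S : Fin N → ℕ) (w : List (Fin N × Fin l)) : ℕ := costFrom S 0 0 w

/-- The objective function `|w| - cost w`. -/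
def obj {N l : ℕ} (S : Fin N → ℕ) (w : List (Fin N × Fin l)) : ℤ := (w.length : ℤ) - cost S w

/-- `w` maximizes `|w| - cost w` among all matchings of blanks to non-zero symbols of `z`. -/
def IsOptimalMatching {F : Type*} [Zero F] {N : ℕ} (S : Fin N → ℕ) (z : List F)
    (w : List (Fin N × Fin z.length)) : Prop :=
  IsMatching z w ∧ ∀ w' : List (Fin N × Fin z.length), IsMatching z w' → obj S w' ≤ obj S w

/-- Each matched blank is filled with the symbol it is matched to, each other blank with `0`. -/
def fill {F : Type*} [Zero F] {N : ℕ} (z : List F) (w : List (Fin N × Fin z.length)) : Fin N → F :=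
  fun i => match w.find? (fun b => b.1 = i) with
    | some b => z.get b.2
    | none => 0

/-! ## A random access machine with a step count

Memory is an array of rows of natural numbers with indirect addressing. The arithmetic operations are
addition and truncated subtraction, so that running times are polynomially related to those of Turing
machines. One instruction calls an external subroutine. -/

/-- Memory: row, column, content. -/
abbrev Memory := ℕ → ℕ → ℕ

/-- Arithmetic expressions; `cell r i` is the content of column `i` of row `r`. -/
inductive RamExpr
  | const (k : ℕ)
  | add (e f : RamExpr)
  | sub (e f : RamExpr)
  | cell (r i : RamExpr)

/-- The value of an expression. -/
def RamExpr.eval (M : Memory) : RamExpr → ℕ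
  | .const k => k
  | .add e f => e.eval M + f.eval M
  | .sub e f => e.eval M - f.eval M
  | .cell r i => M (r.eval M) (i.eval M)

/-- The number of steps taken by the evaluation of an expression: one for each operation. -/
def RamExpr.size : RamExpr → ℕ
  | .const _ => 1
  | .add e f => e.size + f.size + 1
  | .sub e f => e.size + f.size + 1
  | .cell r i => r.size + i.size + 1

/-- Programs: `write r i e` stores `e` in column `i` of row `r`, `cond e f c d` executes `c` if `e < f`
and `d` otherwise, `loop e f c` executes `c` as long as `e < f`, and `call` runs the subroutine. -/
inductive RamProg
  | write (r i e : RamExpr)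
  | seq (c d : RamProg)
  | cond (e f : RamExpr) (c d : RamProg)
  | loop (e f : RamExpr) (c : RamProg)
  | call

/-- `Runs A T c M M' t`: started on memory `M`, the program `c` halts after `t` steps with memory
`M'`. The subroutine replaces row `4` by the result of applying `A` to row `3`, and takes `T` steps. -/
inductive Runs (A : (ℕ → ℕ) → ℕ → ℕ) (T : ℕ) : RamProg → Memory → Memory → ℕ → Prop
  | write (r i e : RamExpr) (M : Memory) :
      Runs A T (.write r i e) M
        (Function.update M (r.eval M) (Function.update (M (r.eval M)) (i.eval M) (e.eval M)))
        (r.size + i.size + e.size + 1)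
  | seq {c d : RamProg} {M M' M'' : Memory} {s t : ℕ} :
      Runs A T c M M' s → Runs A T d M' M'' t → Runs A T (.seq c d) M M'' (s + t)
  | condTrue {e f : RamExpr} {c d : RamProg} {M M' : Memory} {t : ℕ} :
      e.eval M < f.eval M → Runs A T c M M' t →
        Runs A T (.cond e f c d) M M' (e.size + f.size + 1 + t)
  | condFalse {e f : RamExpr} {c d : RamProg} {M M' : Memory} {t : ℕ} :
      ¬ e.eval M < f.eval M → Runs A T d M M' t →
        Runs A T (.cond e f c d) M M' (e.size + f.size + 1 + t)
  | loopStep {e f : RamExpr} {c : RamProg} {M M' M'' : Memory} {s t : ℕ} :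
      e.eval M < f.eval M → Runs A T c M M' s → Runs A T (.loop e f c) M' M'' t →
        Runs A T (.loop e f c) M M'' (e.size + f.size + 1 + s + t)
  | loopEnd {e f : RamExpr} {c : RamProg} {M : Memory} :
      ¬ e.eval M < f.eval M → Runs A T (.loop e f c) M M (e.size + f.size + 1)
  | call (M : Memory) :
      Runs A T .call M (Function.update M 4 (A (M 3))) (T + 1)

/-- The subroutine `A` computes the map `D`, the elements of `F` being given by their labels: applied
to a row that starts with the `N` symbols of `y`, it returns a row that starts with the `m` symbols
of `D y`. -/
def Implements {F : Type*} {N m : ℕ} (label : F → ℕ) (D : (Fin N → F) → Fin m → F)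
    (A : (ℕ → ℕ) → ℕ → ℕ) : Prop :=
  ∀ (r : ℕ → ℕ) (y : Fin N → F), (∀ i : Fin N, r i = label (y i)) →
    ∀ k : Fin m, A r k = label (D y k)

/-- The initial memory of the decoder: row `0` holds the number of runs and the length of the received
word `z`, row `1` the run lengths `S`, row `2` the symbols of `z`; all other cells are `0`. -/
def initMemory {F : Type*} {N : ℕ} (label : F → ℕ) (S : Fin N → ℕ) (z : List F) : Memory
  | 0, 0 => N
  | 0, 1 => z.length
  | 1, i => if h : i < N then S ⟨i, h⟩ else 0
  | 2, i => if h : i < z.length then label (z.get ⟨i, h⟩) else 0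
  | _, _ => 0

/-- On input `(S, z)` the program `P` halts within `B` steps, with the message `x` in row `4`. -/
def DecodesWithin {F : Type*} {N m : ℕ} (label : F → ℕ) (A : (ℕ → ℕ) → ℕ → ℕ) (T : ℕ) (P : RamProg)
    (S : Fin N → ℕ) (z : List F) (x : Fin m → F) (B : ℕ) : Prop :=
  ∃ (M : Memory) (t : ℕ), Runs A T P (initMemory label S z) M t ∧ t ≤ B ∧
    ∀ k : Fin m, M 4 k = label (x k)

end InsdelCode

open InsdelCode

/-!
Let `κ = κC / 100`. If `z` arises from `interleave S y` by at most `κ` insertions and deletions,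
the symbols that survive match blanks of the template to non-zero symbols of `z`, and this true
matching misses at most one non-zero symbol of `y` for each deletion and pays at most once for
each edit. An optimal matching is at least as good, so it leaves few non-zero
symbols unmatched and its cost is at most `2 * κ`.
Consider a pair of an optimal matching that matches a symbol to a wrong blank. Unless the pair
pays, or an edit takes place next to it, it has the same distance from its predecessor in the
template and in `z`; as the two symbols of `z` come from other blanks, two different gaps of the
template have the same length (`IsAlignment.countP_isBad_add_le`). Hence, if no `κ + 1` such
coincidences occur in increasing order, the word filled in is within Hamming distance
`14 * κ ≤ κC` of the codeword (`IsOptimalMatching.hammingDist_fill_le`), and the Hamming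
decoder finds the message. The edit distance of the code follows from the correction of errors, since two strings at
distance at most `2 * κ` have a common neighbour at distance at most `κ` from both.

A coincidence determines the last run that takes part in it from the earlier ones. Therefore `t`
given coincidences in increasing order have probability at most `a ^ (-t)`
(`runLaw_real_coincidences_le`). A pattern of `t` coincidences consists of four increasing
sequences of `t` blanks, so there are at most `((N + 1).choose t) ^ 4` patterns, which is at most
`(N / κC) ^ (44 * t)`. With `a ≥ (N / κC) ^ 45` the union bound gives the failure probability
`2 ^ (-t)` for `t = κ + 1`. The length of the code is controlled by Hoeffding's inequality; for
short codes the claimed bound exceeds `1` (`exists_length_exponent`).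

The decoder is a dynamic program. Its table holds, for each blank `i` and each position `j`, the
best objective of a matching that continues after a match of `i` to `j`, with a pointer to the
first match of an optimal continuation. All pairs `(i, j)` and `(i', j')` with `i < i'` and
`j < j'` are compared, which takes time of the order `(n + |z| + 1) ^ 4`; then the pointers are
followed from `(0, 0)`.
-/

namespace InsdelCode

/-! ### Prefix positions and coinciding gaps -/

/-- The position of the `u`-th blank of the template, blanks being counted from `1`; the virtual
blank `0` sits at position `0`. -/
def prefixPos {N : ℕ} (S : Fin N → ℕ) (u : ℕ) : ℕ := ∑ k : Fin N with k.val < u, (S k + 1)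

@[simp] lemma prefixPos_zero {N : ℕ} (S : Fin N → ℕ) : prefixPos S 0 = 0 := by
  simp [prefixPos]

lemma prefixPos_succ {N : ℕ} (S : Fin N → ℕ) (i : Fin N) :
    prefixPos S (i + 1) = prefixPos S i + (S i + 1) := by
  have : (Finset.univ.filter fun k : Fin N => k.val < i.val + 1)
      = insert i (Finset.univ.filter fun k : Fin N => k.val < i.val) := by
    ext k
    simp only [Finset.mem_filter, Finset.mem_univ, true_and, Finset.mem_insert, Fin.ext_iff]
    omega
  rw [prefixPos, this, Finset.sum_insert (by simp), add_comm, prefixPos]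

lemma blankPos_eq_prefixPos {N : ℕ} (S : Fin N → ℕ) (i : Fin N) :
    blankPos S i = prefixPos S (i + 1) := by
  refine Finset.sum_congr (Finset.ext fun k => ?_) fun _ _ => rfl
  rw [Finset.mem_Iic, Finset.mem_filter_univ, Fin.le_def, Nat.lt_succ_iff]

lemma prefixPos_mono {N : ℕ} (S : Fin N → ℕ) : Monotone (prefixPos S) := fun u v h =>
  Finset.sum_le_sum_of_subset fun k hk => by
    simp only [Finset.mem_filter, Finset.mem_univ, true_and] at hk ⊢
    omega

lemma prefixPos_lt {N : ℕ} (S : Fin N → ℕ) {u v : ℕ} (h : u < v) (hv : v ≤ N) :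
    prefixPos S u < prefixPos S v :=
  calc prefixPos S u < prefixPos S (u + 1) := by
        rw [prefixPos_succ S ⟨u, h.trans_le hv⟩]
        exact Nat.lt_add_of_pos_right (Nat.succ_pos _)
    _ ≤ prefixPos S v := prefixPos_mono S h

/-- `prefixPos S u` depends only on the runs before blank `u`. -/
lemma prefixPos_congr {N : ℕ} {S S' : Fin N → ℕ} {u : ℕ}
    (h : ∀ k : Fin N, k.val < u → S k = S' k) : prefixPos S u = prefixPos S' u :=
  Finset.sum_congr rfl fun k hk => by rw [h k (by simpa using hk)]

/-- A pair of gaps of the template: the gap from blank `u` to blank `v`, and the one from blank `u'`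
to blank `v'`. -/
structure GapPair where
  /-- start of the first gap -/
  u : ℕ
  /-- end of the first gap -/
  v : ℕ
  /-- start of the second gap -/
  u' : ℕ
  /-- end of the second gap -/
  v' : ℕ

/-- The two gaps are nonempty, lie in the template with `N` blanks, and end at different blanks. -/
def GapPair.Proper (N : ℕ) (g : GapPair) : Prop :=
  g.u < g.v ∧ g.u' < g.v' ∧ g.v ≠ g.v' ∧ g.v ≤ N ∧ g.v' ≤ N

/-- For the run lengths `S` the two gaps have the same length; subtractions are avoided. -/
def GapPair.Coincides {N : ℕ} (S : Fin N → ℕ) (g : GapPair) : Prop :=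
  prefixPos S g.v + prefixPos S g.u' = prefixPos S g.v' + prefixPos S g.u

/-- All four ends of `g` precede the corresponding ends of `h`. -/
def GapPair.Before (g h : GapPair) : Prop :=
  g.u < h.u ∧ g.v < h.v ∧ g.u' < h.u' ∧ g.v' < h.v'

/-- A coincidence determines the last run in it from the runs before. -/
lemma GapPair.Coincides.eq_of_agree {N : ℕ} {S S' : Fin N → ℕ} {g : GapPair} (hg : g.Proper N)
    (h : g.Coincides S) (h' : g.Coincides S') (i : Fin N) (hi : i.val + 1 = max g.v g.v')
    (hS : ∀ k : Fin N, k < i → S k = S' k) : S i = S' i := by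
  obtain ⟨h1, h2, h3, h4, h5⟩ := hg
  unfold Coincides at h h'
  have key : ∀ u : ℕ, u ≤ i.val → prefixPos S u = prefixPos S' u := fun u hu =>
    prefixPos_congr fun k hk => hS k (Fin.lt_def.2 (by omega))
  rcases lt_or_gt_of_ne h3 with hlt | hlt
  · rw [max_eq_right hlt.le] at hi
    rw [← hi, prefixPos_succ, key _ (by omega), key _ (by omega), key _ (by omega),
      key _ (by omega)] at h
    rw [← hi, prefixPos_succ] at h'
    omega
  · rw [max_eq_left hlt.le] at hi
    rw [← hi, prefixPos_succ, key _ (by omega), key _ (by omega), key _ (by omega),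
      key _ (by omega)] at h
    rw [← hi, prefixPos_succ] at h'
    omega

open scoped Classical in
/-- Each of `t` successive coincidences fixes one of the `N` run lengths. -/
lemma card_coincidences_le {N a t : ℕ} (g : Fin t → GapPair) (hg : ∀ k, (g k).Proper N)
    (hmono : ∀ k l, k < l → (g k).Before (g l)) :
    ((Fintype.piFinset fun _ : Fin N => Finset.Icc 1 a).filter
      fun S => ∀ k, (g k).Coincides S).card * a ^ t ≤ a ^ N := by
  classical
  -- `last k` is the last run that takes part in the `k`-th coincidence
  have hlt : ∀ k, max (g k).v (g k).v' - 1 < N := fun k => by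
    obtain ⟨h1, h2, h3, h4, h5⟩ := hg k; omega
  let last : Fin t → Fin N := fun k => ⟨max (g k).v (g k).v' - 1, hlt k⟩
  have hlast : ∀ k, (last k).val + 1 = max (g k).v (g k).v' := fun k => by
    obtain ⟨h1, h2, h3, h4, h5⟩ := hg k
    simp only [last]; omega
  have hinj : Function.Injective last := by
    refine StrictMono.injective fun k l hkl => Fin.lt_def.2 ?_
    obtain ⟨-, h2, -, h4⟩ := hmono k l hkl
    have := hlast k; have := hlast l; omega
  set M : Finset (Fin N) := Finset.univ.image last with hM
  have hMcard : M.card = t := by rw [hM, Finset.card_image_of_injective _ hinj]; simp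
  have hle : ((Fintype.piFinset fun _ : Fin N => Finset.Icc 1 a).filter
      fun S => ∀ k, (g k).Coincides S).card ≤
      (Fintype.piFinset fun _ : {i : Fin N // i ∉ M} => Finset.Icc 1 a).card := by
    refine Finset.card_le_card_of_injOn (fun S i => S i) ?_ ?_
    · intro S hS
      simp only [Finset.coe_filter, Fintype.mem_piFinset, Set.mem_ofPred_eq] at hS
      simp only [Finset.mem_coe, Fintype.mem_piFinset]
      exact fun i => hS.1 i
    · intro S hS S' hS' heq
      simp only [Finset.coe_filter, Fintype.mem_piFinset, Set.mem_ofPred_eq] at hS hS'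
      funext i
      induction i using WellFoundedLT.induction with
      | _ i ih =>
        by_cases hi : i ∈ M
        · obtain ⟨k, -, rfl⟩ := Finset.mem_image.1 hi
          exact (hS.2 k).eq_of_agree (hg k) (hS'.2 k) _ (hlast k) ih
        · exact congrFun heq ⟨i, hi⟩
  have hcompl : Fintype.card {i : Fin N // i ∉ M} = N - t := by
    rw [Fintype.card_subtype_compl]; simp [hMcard]
  have htN : t ≤ N := by simpa [hMcard] using Finset.card_le_univ M
  calc _ ≤ a ^ (N - t) * a ^ t := by
        refine Nat.mul_le_mul_right _ (hle.trans_eq ?_)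
        simp [hMcard]
    _ = a ^ N := by rw [← pow_add, Nat.sub_add_cancel htN]

/-! ### Probability of coincidences -/

lemma uniformOn_Icc_singleton {a x : ℕ} (hx : x ∈ Finset.Icc 1 a) :
    ProbabilityTheory.uniformOn (Set.Icc 1 a) {x} = (a : ENNReal)⁻¹ := by
  have := ProbabilityTheory.uniformOn_apply_finset (s := Finset.Icc 1 a) (t := {x})
  rw [Finset.inter_singleton_of_mem hx] at this
  simpa using this

lemma isProbabilityMeasure_uniformOn_Icc {a : ℕ} (ha : 1 ≤ a) :
    IsProbabilityMeasure (ProbabilityTheory.uniformOn (Set.Icc 1 a)) :=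
  ProbabilityTheory.isProbabilityMeasure_uniformOn (Set.finite_Icc 1 a) ⟨1, by simp [ha]⟩

lemma isProbabilityMeasure_runLaw {N a : ℕ} (ha : 1 ≤ a) : IsProbabilityMeasure (runLaw N a) := by
  have := isProbabilityMeasure_uniformOn_Icc ha
  unfold runLaw; infer_instance

lemma ae_uniformOn_Icc {a : ℕ} (ha : 1 ≤ a) :
    ∀ᵐ x ∂(ProbabilityTheory.uniformOn (Set.Icc 1 a) : Measure ℕ), x ∈ Set.Icc 1 a := by
  have := isProbabilityMeasure_uniformOn_Icc ha
  refine ( mem_ae_iff_prob_eq_one₀ (MeasurableSet.of_discrete).nullMeasurableSet).2 ?_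
  exact ProbabilityTheory.uniformOn_self (Set.finite_Icc 1 a) ⟨1, by simp [ha]⟩

lemma ae_runLaw {N a : ℕ} (ha : 1 ≤ a) : ∀ᵐ S ∂runLaw N a, ∀ i, S i ∈ Finset.Icc 1 a := by
  have := isProbabilityMeasure_uniformOn_Icc ha
  rw [ae_all_iff]
  intro i
  have := (Measure.quasiMeasurePreserving_eval
    (fun _ : Fin N => (ProbabilityTheory.uniformOn (Set.Icc 1 a) : Measure ℕ)) i).ae
    (ae_uniformOn_Icc ha)
  simpa [runLaw] using this

/-- Events are bounded by counting the run lengths in `{1, …, a}`. -/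
lemma runLaw_real_le_card {N a : ℕ} (ha : 1 ≤ a) (E : (Fin N → ℕ) → Prop) [DecidablePred E] :
    (runLaw N a).real {S | E S} ≤
      ((Fintype.piFinset fun _ : Fin N => Finset.Icc 1 a).filter E).card * ((a : ℝ) ^ N)⁻¹ := by
  have := isProbabilityMeasure_runLaw (N := N) ha
  have := isProbabilityMeasure_uniformOn_Icc ha
  set A := (Fintype.piFinset fun _ : Fin N => Finset.Icc 1 a).filter E with hA
  have h1 : (runLaw N a).real {S | E S} ≤ (runLaw N a).real (A : Set (Fin N → ℕ)) := by
    refine ENNReal.toReal_mono (measure_ne_top _ _) (measure_mono_ae ?_)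
    filter_upwards [ae_runLaw (N := N) ha] with S hS hE
    simp only [hA, Finset.coe_filter]
    exact ⟨Fintype.mem_piFinset.2 hS, hE⟩
  refine h1.trans ?_
  rw [← sum_measureReal_singleton, ← nsmul_eq_mul]
  refine Finset.sum_le_card_nsmul _ _ _ fun S hS => le_of_eq ?_
  simp only [hA, Finset.mem_filter, Fintype.mem_piFinset] at hS
  rw [runLaw, measureReal_def, ← Set.univ_pi_singleton, Measure.pi_pi,
    Finset.prod_congr rfl fun i _ => uniformOn_Icc_singleton (hS.1 i)]
  simp

/-- The probability of `t` given successive coincidences. -/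
lemma runLaw_real_coincidences_le {N a t : ℕ} (ha : 1 ≤ a) (g : Fin t → GapPair)
    (hg : ∀ k, (g k).Proper N) (hmono : ∀ k l, k < l → (g k).Before (g l)) :
    (runLaw N a).real {S | ∀ k, (g k).Coincides S} ≤ ((a : ℝ) ^ t)⁻¹ := by
  classical
  have ha' : (0 : ℝ) < a := by exact_mod_cast ha
  refine (runLaw_real_le_card ha _).trans ?_
  rw [← div_eq_mul_inv, div_le_iff₀ (by positivity), ← div_eq_inv_mul, le_div_iff₀ (by positivity)]
  exact_mod_cast card_coincidences_le (a := a) g hg hmono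

/-- `t` proper pairs of gaps, in increasing order, coincide for the run lengths `S`. -/
def HasCoincidences {N : ℕ} (S : Fin N → ℕ) (t : ℕ) : Prop :=
  ∃ g : Fin t → GapPair, (∀ k, (g k).Proper N) ∧ (∀ k l, k < l → (g k).Before (g l)) ∧
    ∀ k, (g k).Coincides S

lemma card_orderEmbedding_fin (t n : ℕ) : Fintype.card (Fin t ↪o Fin n) = n.choose t := by
  rw [Fintype.card_eq_nat_card, Nat.card_congr Set.powersetCard.ofFinEmbEquiv,
    Set.powersetCard.card]
  simp

/-- The union bound over the `(N + 1 choose t) ^ 4` patterns of coincidences. -/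
lemma runLaw_real_hasCoincidences_le {N a : ℕ} (ha : 1 ≤ a) (t : ℕ) :
    (runLaw N a).real {S | HasCoincidences S t} ≤ ((N + 1).choose t : ℝ) ^ 4 * ((a : ℝ) ^ t)⁻¹ := by
  classical
  have := isProbabilityMeasure_runLaw (N := N) ha
  let Q := (Fin t ↪o Fin (N + 1)) × (Fin t ↪o Fin (N + 1)) × (Fin t ↪o Fin (N + 1)) ×
    (Fin t ↪o Fin (N + 1))
  let gap : Q → Fin t → GapPair := fun q k => ⟨q.1 k, q.2.1 k, q.2.2.1 k, q.2.2.2 k⟩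
  let E : Q → Set (Fin N → ℕ) := fun q =>
    {S | (∀ k, (gap q k).Proper N) ∧ ∀ k, (gap q k).Coincides S}
  have hsub : {S : Fin N → ℕ | HasCoincidences S t} ⊆ ⋃ q, E q := by
    rintro S ⟨g, hg, hmono, hS⟩
    let emb (f : GapPair → ℕ) (hf : ∀ k, f (g k) < N + 1) (hlt : ∀ k l, k < l → f (g k) < f (g l)) :
        Fin t ↪o Fin (N + 1) := OrderEmbedding.ofStrictMono (fun k => ⟨f (g k), hf k⟩) hlt
    refine Set.mem_iUnion.2 ⟨⟨emb (·.u) (fun k => ?_) fun k l h => (hmono k l h).1,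
      emb (·.v) (fun k => ?_) fun k l h => (hmono k l h).2.1,
      emb (·.u') (fun k => ?_) fun k l h => (hmono k l h).2.2.1,
      emb (·.v') (fun k => ?_) fun k l h => (hmono k l h).2.2.2⟩, ?_⟩
    iterate 4 (obtain ⟨h1, h2, -, h4, h5⟩ := hg k; simp only [Nat.lt_succ_iff]; omega)
    exact ⟨hg, hS⟩
  have hE : ∀ q, (runLaw N a).real (E q) ≤ ((a : ℝ) ^ t)⁻¹ := by
    intro q
    by_cases hq : ∀ k, (gap q k).Proper N
    · refine (measureReal_mono fun S hS => hS.2).trans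
        (runLaw_real_coincidences_le ha (gap q) hq fun k l h => ?_)
      exact ⟨q.1.strictMono h, q.2.1.strictMono h, q.2.2.1.strictMono h, q.2.2.2.strictMono h⟩
    · have : E q = ∅ := by
        ext S
        simp only [E, Set.mem_ofPred_eq, hq, false_and, Set.mem_empty_iff_false]
      rw [this]; simp
  calc _ ≤ (runLaw N a).real (⋃ q, E q) := measureReal_mono hsub
    _ ≤ ∑ q, (runLaw N a).real (E q) := measureReal_iUnion_fintype_le _
    _ ≤ ∑ _q : Q, ((a : ℝ) ^ t)⁻¹ := Finset.sum_le_sum fun q _ => hE q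
    _ = _ := by
      simp only [Finset.sum_const, Finset.card_univ, Q, Fintype.card_prod,
        card_orderEmbedding_fin, nsmul_eq_mul]
      push_cast; ring

/-! ### Estimates for the failure probability -/

/-- For `a ≥ (N / κ) ^ 45` the number of patterns in the union bound is small compared with
`a ^ t`. -/
lemma choose_pow_four_mul_inv_le {N κ t a : ℕ} (hκ : 1 ≤ κ) (hκN : 2 * κ ≤ N)
    (ht : κ ≤ 100 * t) (ha : ((N : ℝ) / κ) ^ 45 ≤ a) :
    ((N + 1).choose t : ℝ) ^ 4 * ((a : ℝ) ^ t)⁻¹ ≤ (2⁻¹ : ℝ) ^ t := by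
  set ρ : ℝ := (N : ℝ) / κ with hρ
  have hκ0 : (0 : ℝ) < κ := by exact_mod_cast hκ
  have hρ2 : 2 ≤ ρ := by
    rw [hρ, le_div_iff₀ hκ0]; exact_mod_cast hκN
  have hNρ : (N : ℝ) = ρ * κ := by rw [hρ]; field_simp
  have hN : ((N + 1 : ℕ) : ℝ) ≤ 200 * ρ * t := by
    have h1 : (1 : ℝ) ≤ N := by exact_mod_cast (show 1 ≤ N by omega)
    have h2 : (κ : ℝ) ≤ 100 * t := by exact_mod_cast ht
    push_cast
    nlinarith [mul_le_mul_of_nonneg_left h2 (by linarith : (0 : ℝ) ≤ ρ)]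
  have hfac : (t : ℝ) ^ t ≤ 3 ^ t * (t.factorial : ℝ) := by
    have h := Real.pow_div_factorial_le_exp (x := (t : ℝ)) (by positivity) t
    have h3 : Real.exp t ≤ 3 ^ t := by
      rw [← mul_one (t : ℝ), Real.exp_nat_mul]
      exact pow_le_pow_left₀ (Real.exp_pos _).le (by linarith [Real.exp_one_lt_d9]) _
    rw [div_le_iff₀ (by positivity)] at h
    exact h.trans (by gcongr)
  have hchoose : ((N + 1).choose t : ℝ) ≤ (ρ ^ 11) ^ t := by
    have h := Nat.choose_le_pow_div (α := ℝ) t (N + 1)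
    refine h.trans ?_
    rw [div_le_iff₀ (by positivity)]
    have h600 : 600 * ρ ≤ ρ ^ 11 := by
      have : (2 : ℝ) ^ 10 ≤ ρ ^ 10 := pow_le_pow_left₀ (by norm_num) hρ2 _
      nlinarith
    calc ((N + 1 : ℕ) : ℝ) ^ t ≤ (200 * ρ * t) ^ t := pow_le_pow_left₀ (by positivity) hN _
      _ = (200 * ρ) ^ t * (t : ℝ) ^ t := mul_pow _ _ _
      _ ≤ (200 * ρ) ^ t * (3 ^ t * (t.factorial : ℝ)) := by gcongr
      _ = (600 * ρ) ^ t * t.factorial := by rw [← mul_assoc, ← mul_pow]; ring_nf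
      _ ≤ _ := by gcongr
  have hapos : (0 : ℝ) < a := lt_of_lt_of_le (by positivity) ha
  rw [← div_eq_mul_inv, div_le_iff₀ (by positivity)]
  calc ((N + 1).choose t : ℝ) ^ 4 ≤ ((ρ ^ 11) ^ t) ^ 4 := by gcongr
    _ = (ρ ^ 44) ^ t := by ring
    _ ≤ (2⁻¹ * (a : ℝ)) ^ t := by
      gcongr
      have : 2 * ρ ^ 44 ≤ ρ ^ 45 := by
        rw [pow_succ' ρ 44]; gcongr
      linarith
    _ = _ := mul_pow _ _ _

/-! ### The length of the code -/

lemma integral_uniformOn_Icc {a : ℕ} (ha : 1 ≤ a) :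
    ∫ x, (x : ℝ) ∂(ProbabilityTheory.uniformOn (Set.Icc 1 a) : Measure ℕ) = ((a : ℝ) + 1) / 2 := by
  have := isProbabilityMeasure_uniformOn_Icc ha
  have h1 : (ProbabilityTheory.uniformOn (Set.Icc 1 a) : Measure ℕ).restrict
      (Finset.Icc 1 a : Finset ℕ) = ProbabilityTheory.uniformOn (Set.Icc 1 a) := by
    rw [Measure.restrict_eq_self_of_ae_mem]
    simpa using ae_uniformOn_Icc ha
  have hg : ∀ n : ℕ, (∑ x ∈ Finset.Icc 1 n, (x : ℝ)) = n * (n + 1) / 2 := fun n => by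
    induction n with
    | zero => simp
    | succ n ih => rw [Finset.sum_Icc_succ_top (by omega), ih]; push_cast; ring
  have ha0 : (a : ℝ) ≠ 0 := by positivity
  rw [← h1, setIntegral_finset _ (IntegrableOn.finset)]
  rw [Finset.sum_congr rfl fun x hx => by rw [measureReal_def, uniformOn_Icc_singleton hx]]
  rw [← Finset.smul_sum, hg]
  simp only [ENNReal.toReal_inv, ENNReal.toReal_natCast, smul_eq_mul]
  field_simp

/-- Hoeffding's inequality for one of the two tails, selected by `s = 1` or `s = -1`. -/
lemma runLaw_real_tail_le {N a : ℕ} (ha : 1 ≤ a) {α : ℝ} (hα : 0 ≤ α) (s : ℝ) (hs : s ^ 2 = 1) :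
    (runLaw N a).real {S | α * N * (a + 1) / 2 ≤ ∑ i, s * ((S i : ℝ) - ((a : ℝ) + 1) / 2)} ≤
      Real.exp (-(α ^ 2 / 2 * N)) := by
  have := isProbabilityMeasure_uniformOn_Icc ha
  have := isProbabilityMeasure_runLaw (N := N) ha
  set μ : Measure ℕ := ProbabilityTheory.uniformOn (Set.Icc 1 a) with hμ
  have ha0 : (0 : ℝ) < a := by exact_mod_cast ha
  rcases Nat.eq_zero_or_pos N with rfl | hN
  · simp
  -- each run is treated as a variable with values in `[0, a + 1]`
  have hsub : ∀ i : Fin N, ProbabilityTheory.HasSubgaussianMGF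
      (fun S : Fin N → ℕ => s * ((S i : ℝ) - ((a : ℝ) + 1) / 2))
      ((‖(a + 1 : ℝ) - 0‖₊ / 2) ^ 2) (runLaw N a) := by
    intro i
    have h0 : ProbabilityTheory.HasSubgaussianMGF (fun x : ℕ => (x : ℝ) - ∫ x : ℕ, (x : ℝ) ∂μ)
        ((‖(a + 1 : ℝ) - 0‖₊ / 2) ^ 2) μ := by
      refine ProbabilityTheory.hasSubgaussianMGF_of_mem_Icc
        (measurable_of_countable _).aemeasurable ?_
      filter_upwards [ae_uniformOn_Icc ha] with x hx
      have : (x : ℝ) ≤ a := by exact_mod_cast hx.2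
      exact ⟨by positivity, by linarith⟩
    rw [integral_uniformOn_Icc ha] at h0
    have h1 : ProbabilityTheory.HasSubgaussianMGF
        (fun x : ℕ => s * ((x : ℝ) - ((a : ℝ) + 1) / 2)) ((‖(a + 1 : ℝ) - 0‖₊ / 2) ^ 2) μ := by
      rcases (sq_eq_sq_iff_eq_or_eq_neg.1 (hs.trans (one_pow 2).symm)) with rfl | rfl
      · simpa only [one_mul] using h0
      · simp only [neg_one_mul]
        exact h0.neg
    have hmap : (runLaw N a).map (fun S => S i) = μ :=
      (measurePreserving_eval (fun _ : Fin N => μ) i).map_eq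
    rw [← hmap] at h1
    exact ProbabilityTheory.HasSubgaussianMGF.of_map (Y := fun S : Fin N → ℕ => S i)
      (measurable_pi_apply i).aemeasurable h1
  have hind : ProbabilityTheory.iIndepFun
      (fun (i : Fin N) (S : Fin N → ℕ) => s * ((S i : ℝ) - ((a : ℝ) + 1) / 2)) (runLaw N a) :=
    ProbabilityTheory.iIndepFun_pi (μ := fun _ : Fin N => μ)
      (X := fun _ (x : ℕ) => s * ((x : ℝ) - ((a : ℝ) + 1) / 2))
      fun _ => (measurable_of_countable _).aemeasurable
  have h := ProbabilityTheory.HasSubgaussianMGF.measure_sum_ge_le_of_iIndepFun hind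
    (s := Finset.univ) (fun i _ => hsub i) (ε := α * N * (a + 1) / 2) (by positivity)
  refine h.trans (Real.exp_le_exp.2 (le_of_eq ?_))
  have hN0 : (0 : ℝ) < N := by exact_mod_cast hN
  have hn : ‖(a + 1 : ℝ)‖ = a + 1 := Real.norm_of_nonneg (by positivity)
  simp only [sub_zero, Finset.sum_const, Finset.card_univ, Fintype.card_fin, nsmul_eq_mul,
    NNReal.coe_mul, NNReal.coe_natCast, NNReal.coe_pow, NNReal.coe_div, coe_nnnorm,
    NNReal.coe_ofNat, hn]
  field_simp

/-- The length of the code is concentrated around its mean. -/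
lemma runLaw_real_length_le {N a : ℕ} (ha : 1 ≤ a) {α : ℝ} (hα : 0 ≤ α) :
    (runLaw N a).real {S | ¬ ((blockLength S : ℝ) ∈ Set.Icc ((1 - α) * N * (a + 1) / 2 + N)
      ((1 + α) * N * (a + 1) / 2 + N))} ≤ 2 * Real.exp (-(α ^ 2 / 2 * N)) := by
  have := isProbabilityMeasure_runLaw (N := N) ha
  have h1 := runLaw_real_tail_le (N := N) ha hα 1 (by norm_num)
  have h2 := runLaw_real_tail_le (N := N) ha hα (-1) (by norm_num)
  rw [two_mul]
  refine le_trans ?_ (add_le_add h1 h2)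
  refine le_trans (measureReal_mono ?_) (measureReal_union_le _ _)
  intro S hS
  simp only [Set.mem_ofPred_eq, Set.mem_Icc, not_and_or, not_le, blockLength] at hS
  push_cast at hS
  simp only [Set.mem_union, Set.mem_ofPred_eq, ← Finset.mul_sum, Finset.sum_sub_distrib,
    Finset.sum_const, Finset.card_univ, Fintype.card_fin, nsmul_eq_mul]
  rcases hS with hS | hS
  · right; nlinarith
  · left; nlinarith

/-- Choice of the constant `c'`. For long codes the two exponentially small terms are absorbed by a
smaller exponent. For short codes `a` is bounded in terms of `K₁` and `α`, so that
`2 ^ (-(c * α * a * N))` is bounded away from zero and the bound exceeds `1` for small `c'`. -/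
lemma exists_length_exponent {c : ℝ} (hc : 0 < c) (K₁ : ℕ) {α : ℝ} (hα : 0 < α) :
    ∃ c' : ℝ, 0 < c' ∧ ∀ (N κ a : ℕ) (p : ℝ), 1 ≤ κ → κ ≤ N → (a : ℝ) ≤ (N : ℝ) ^ K₁ → p ≤ 1 →
      p ≤ (2 : ℝ) ^ (-(c * κ)) + 2 * Real.exp (-(α ^ 2 / 2 * N)) →
      p ≤ (2 : ℝ) ^ (-(c' * κ)) + (2 : ℝ) ^ (-(c * α * a * N)) := by
  have hL0 : 0 < Real.log 2 := Real.log_pos (by norm_num)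
  have hL1 : Real.log 2 ≤ 1 := by linarith [Real.log_two_lt_d9]
  have h2 : ∀ x : ℝ, (2 : ℝ) ^ x = Real.exp (Real.log 2 * x) := fun x =>
    Real.rpow_def_of_pos (by norm_num) x
  set γ : ℝ := min (c * Real.log 2) (α ^ 2 / 4) / 2 with hγ
  have hγ0 : 0 < γ := by positivity
  have hγ1 : 2 * γ ≤ c * Real.log 2 := by
    have := min_le_left (c * Real.log 2) (α ^ 2 / 4); linarith
  have hγ2 : 2 * γ ≤ α ^ 2 / 4 := by
    have := min_le_right (c * Real.log 2) (α ^ 2 / 4); linarith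
  obtain ⟨N₀, hN₀⟩ := exists_nat_ge (8 / (γ * α ^ 2) + 1)
  have hN₀1 : (1 : ℝ) ≤ N₀ := le_trans (by simp; positivity) hN₀
  have hN₀2 : 2 / γ ≤ α ^ 2 / 4 * N₀ := by
    have : 8 / (γ * α ^ 2) ≤ N₀ := by linarith
    rw [div_le_iff₀ (by positivity)] at this ⊢
    linarith
  set δ : ℝ := (2 : ℝ) ^ (-(c * α * (N₀ : ℝ) ^ K₁ * N₀)) with hδ
  have hδ0 : 0 < δ := by positivity
  refine ⟨min γ (δ / N₀), by positivity, fun N κ a p hκ hκN ha hp hp' => ?_⟩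
  have hκ1 : (1 : ℝ) ≤ κ := by exact_mod_cast hκ
  have hκN' : (κ : ℝ) ≤ N := by exact_mod_cast hκN
  rcases lt_or_ge N N₀ with hN | hN
  · have hNR : (N : ℝ) ≤ N₀ := by exact_mod_cast hN.le
    have h1 : δ ≤ (2 : ℝ) ^ (-(c * α * a * N)) := by
      refine Real.rpow_le_rpow_of_exponent_le (by norm_num) (neg_le_neg ?_)
      have : (a : ℝ) ≤ (N₀ : ℝ) ^ K₁ := ha.trans (by gcongr)
      gcongr
    have h3 : 1 - δ ≤ (2 : ℝ) ^ (-(min γ (δ / N₀) * κ)) := by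
      rw [h2]
      refine le_trans ?_ (Real.add_one_le_exp _)
      have h4 : min γ (δ / N₀) * κ ≤ δ := by
        calc min γ (δ / N₀) * κ ≤ δ / N₀ * N₀ := by
              gcongr
              · exact min_le_right _ _
              · exact hκN.trans hN.le
          _ = δ := by field_simp
      have h5 : 0 ≤ min γ (δ / N₀) * κ := by positivity
      nlinarith
    linarith
  · have hNR : (N₀ : ℝ) ≤ N := by exact_mod_cast hN
    have h1 : (2 : ℝ) ^ (-(c * κ)) ≤ Real.exp (-(2 * γ * κ)) := by
      rw [h2]
      refine Real.exp_le_exp.2 ?_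
      nlinarith [mul_le_mul_of_nonneg_right hγ1 (by linarith : (0 : ℝ) ≤ κ)]
    have h3 : Real.exp (-(α ^ 2 / 4 * N)) ≤ Real.exp (-(2 * γ * κ)) := by
      refine Real.exp_le_exp.2 (neg_le_neg ?_)
      gcongr
    have h4 : Real.exp (-(α ^ 2 / 4 * N)) ≤ γ / 2 := by
      have h5 : 2 / γ ≤ Real.exp (α ^ 2 / 4 * N) := by
        have := Real.add_one_le_exp (α ^ 2 / 4 * N)
        have : α ^ 2 / 4 * N₀ ≤ α ^ 2 / 4 * N := by gcongr
        linarith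
      rw [Real.exp_neg, inv_le_comm₀ (Real.exp_pos _) (by positivity), inv_div]
      exact h5
    have h6 : Real.exp (-(α ^ 2 / 2 * N)) =
        Real.exp (-(α ^ 2 / 4 * N)) * Real.exp (-(α ^ 2 / 4 * N)) := by
      rw [← Real.exp_add]; ring_nf
    have h7 : p ≤ Real.exp (-(2 * γ * κ)) * Real.exp γ := by
      have h8 : 1 + γ ≤ Real.exp γ := by linarith [Real.add_one_le_exp γ]
      have h9 : Real.exp (-(α ^ 2 / 4 * N)) * Real.exp (-(α ^ 2 / 4 * N)) ≤
          Real.exp (-(2 * γ * κ)) * (γ / 2) :=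
        mul_le_mul h3 h4 (Real.exp_pos _).le (Real.exp_pos _).le
      calc p ≤ Real.exp (-(2 * γ * κ)) * (1 + γ) := by rw [h6] at hp'; linarith
        _ ≤ _ := by gcongr
    have h10 : Real.exp (-(2 * γ * κ)) * Real.exp γ ≤
        (2 : ℝ) ^ (-(min γ (δ / N₀) * κ)) := by
      rw [h2, ← Real.exp_add]
      refine Real.exp_le_exp.2 ?_
      have h11 : Real.log 2 * (min γ (δ / N₀) * κ) ≤ 1 * (γ * κ) := by
        gcongr
        exact min_le_left _ _
      nlinarith
    have : (0 : ℝ) < (2 : ℝ) ^ (-(c * α * a * N)) := by positivity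
    linarith

/-! ### The edit distance -/

section EditDistance

variable {σ : Type*}

lemma EditSteps.trans {j k : ℕ} {x y z : List σ} (h : EditSteps j x y) (h' : EditSteps k y z) :
    EditSteps (j + k) x z := by
  induction h' with
  | refl => exact h
  | insert s _ ih => exact .insert s (ih h)
  | delete s _ ih => exact .delete s (ih h)

lemma EditSteps.symm {k : ℕ} {x y : List σ} (h : EditSteps k x y) : EditSteps k y x := by
  induction h with
  | refl => exact .refl _
  | insert s _ ih => rw [add_comm]; exact (EditSteps.delete s (.refl _)).trans ih
  | delete s _ ih => rw [add_comm]; exact (EditSteps.insert s (.refl _)).trans ih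

lemma EditSteps.exists_split {k : ℕ} {x y : List σ} (h : EditSteps k x y) :
    ∀ i j : ℕ, i + j = k → ∃ z, EditSteps i x z ∧ EditSteps j z y := by
  induction h with
  | refl => intro i j hij; obtain ⟨rfl, rfl⟩ : i = 0 ∧ j = 0 := by omega
            exact ⟨_, .refl _, .refl _⟩
  | insert s h ih =>
    rintro i (_ | j) hij
    · exact ⟨_, by simpa [← hij] using EditSteps.insert s h, .refl _⟩
    · obtain ⟨z, h1, h2⟩ := ih i j (by omega)
      exact ⟨z, h1, .insert s h2⟩
  | delete s h ih =>
    rintro i (_ | j) hij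
    · exact ⟨_, by simpa [← hij] using EditSteps.delete s h, .refl _⟩
    · obtain ⟨z, h1, h2⟩ := ih i j (by omega)
      exact ⟨z, h1, .delete s h2⟩

lemma editSteps_nil (x : List σ) : EditSteps x.length [] x := by
  induction x with
  | nil => exact .refl _
  | cons s x ih => exact .insert (u := []) s ih

lemma editSteps_editDist (x y : List σ) : EditSteps (editDist x y) x y :=
  Nat.sInf_mem (s := {k | EditSteps k x y}) ⟨_, (editSteps_nil x).symm.trans (editSteps_nil y)⟩

lemma EditSteps.editDist_le {k : ℕ} {x y : List σ} (h : EditSteps k x y) : editDist x y ≤ k :=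
  Nat.sInf_le h

/-- Two strings at edit distance at most `2 * k` have a common neighbour at distance at most `k`. -/
lemma exists_editDist_le_of_le_two_mul {k : ℕ} {x y : List σ} (h : editDist x y ≤ 2 * k) :
    ∃ z, editDist x z ≤ k ∧ editDist y z ≤ k := by
  obtain ⟨z, h1, h2⟩ := (editSteps_editDist x y).exists_split
    (min (editDist x y) k) (editDist x y - min (editDist x y) k) (by omega)
  have := h1.editDist_le
  have := h2.symm.editDist_le
  exact ⟨z, by omega, by omega⟩

/-- An edit path leaves a long common subsequence untouched. -/
lemma EditSteps.exists_common_sublist {k : ℕ} {x y : List σ} (h : EditSteps k x y) :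
    ∃ l : List σ, l.Sublist x ∧ l.Sublist y ∧ x.length + y.length ≤ 2 * l.length + k := by
  induction h with
  | refl x => exact ⟨x, .refl x, .refl x, by omega⟩
  | @insert k x u v s h ih =>
    obtain ⟨l, h1, h2, h3⟩ := ih
    refine ⟨l, h1, h2.trans ((List.sublist_cons_self s v).append_left u), ?_⟩
    simp only [List.length_append, List.length_cons] at h3 ⊢
    omega
  | @delete k x u v s h ih =>
    obtain ⟨l, h1, h2, h3⟩ := ih
    obtain ⟨l₁, l₂, rfl, h4, h5⟩ := List.sublist_append_iff.1 h2
    simp only [List.length_append, List.length_cons] at h3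
    rcases List.sublist_cons_iff.1 h5 with h6 | ⟨r, rfl, h6⟩
    · exact ⟨l₁ ++ l₂, h1, h4.append h6, by simp only [List.length_append]; omega⟩
    · refine ⟨l₁ ++ r, ((List.sublist_cons_self s r).append_left l₁).trans h1, h4.append h6, ?_⟩
      simp only [List.length_append, List.length_cons] at h3 ⊢
      omega

end EditDistance

/-! ### The encoding -/

section Encoding

variable {F : Type*} {N : ℕ}

@[simp] lemma length_interleave [Zero F] (S : Fin N → ℕ) (y : Fin N → F) :
    (interleave S y).length = blockLength S := by
  simp [interleave, blockLength, List.length_flatten, List.map_ofFn, Function.comp_def,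
    List.sum_ofFn, Finset.sum_add_distrib, add_comm]

lemma countP_interleave [Zero F] [DecidableEq F] (S : Fin N → ℕ) (y : Fin N → F) :
    (interleave S y).countP (· ≠ 0) = (Finset.univ.filter fun i => y i ≠ 0).card := by
  rw [Finset.card_filter]
  simp only [interleave, List.countP_flatten, List.map_ofFn, Function.comp_def,
    List.sum_ofFn, List.countP_append, List.countP_replicate, List.countP_singleton]
  simp

lemma interleave_succ [Zero F] (S : Fin (N + 1) → ℕ) (y : Fin (N + 1) → F) :
    interleave S y = interleave (fun i => S i.castSucc) (fun i => y i.castSucc) ++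
      (List.replicate (S (Fin.last N)) 0 ++ [y (Fin.last N)]) := by
  rw [interleave, List.ofFn_succ_last, List.flatten_append]
  simp [interleave]

lemma prefixPos_castSucc (S : Fin (N + 1) → ℕ) {u : ℕ} (hu : u ≤ N) :
    prefixPos S u = prefixPos (fun i : Fin N => S i.castSucc) u := by
  simp only [prefixPos, Finset.sum_filter, Fin.sum_univ_castSucc, Fin.val_castSucc, Fin.val_last]
  simp [hu]

lemma prefixPos_last (S : Fin N → ℕ) : prefixPos S N = blockLength S := by
  simp [prefixPos, blockLength, Finset.sum_add_distrib, add_comm]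

/-- Each position of the template is a blank, or carries the symbol `0`. -/
lemma interleave_getElem? [Zero F] (S : Fin N → ℕ) (p : ℕ) (hp : p < blockLength S) :
    (∃ i : Fin N, prefixPos S (i + 1) = p + 1 ∧
      ∀ y : Fin N → F, (interleave S y)[p]? = some (y i)) ∨
      ∀ y : Fin N → F, (interleave S y)[p]? = some 0 := by
  induction N with
  | zero => simp [blockLength] at hp
  | succ N ih =>
    set S' : Fin N → ℕ := fun i => S i.castSucc with hS'
    have hlen : blockLength S = blockLength S' + (S (Fin.last N) + 1) := by
      simp only [blockLength, Fin.sum_univ_castSucc, hS']; omega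
    rcases lt_or_ge p (blockLength S') with h | h
    · rcases ih S' h with ⟨i, h1, h2⟩ | h2
      · refine .inl ⟨i.castSucc, ?_, fun y => ?_⟩
        · rw [Fin.val_castSucc, prefixPos_castSucc S (by omega), h1]
        · rw [interleave_succ, List.getElem?_append_left (by simpa using h), h2]
      · refine .inr fun y => ?_
        rw [interleave_succ, List.getElem?_append_left (by simpa using h), h2]
    · have key : ∀ y : Fin (N + 1) → F, (interleave S y)[p]? =
          (List.replicate (S (Fin.last N)) 0 ++ [y (Fin.last N)])[p - blockLength S']? := by
        intro y
        rw [interleave_succ, List.getElem?_append_right (by simpa using h), length_interleave]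
      rcases lt_or_ge (p - blockLength S') (S (Fin.last N)) with h' | h'
      · refine .inr fun y => ?_
        rw [key, List.getElem?_append_left (by simpa using h')]
        simp [h']
      · refine .inl ⟨Fin.last N, ?_, fun y => ?_⟩
        · rw [Fin.val_last, prefixPos_last, hlen]; omega
        · rw [key, List.getElem?_append_right (by simpa using h')]
          simp only [List.length_replicate]
          rw [show p - blockLength S' - S (Fin.last N) = 0 by omega]
          simp

/-- A linear code followed by the insertion of runs of zeros is linear. -/
lemma exists_linearMap_interleave [Field F] {m : ℕ} (S : Fin N → ℕ)
    (C : (Fin m → F) →ₗ[F] (Fin N → F)) :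
    ∃ L : (Fin m → F) →ₗ[F] (Fin (blockLength S) → F),
      ∀ x, interleave S (C x) = List.ofFn (L x) := by
  have key : ∀ p : Fin (blockLength S), ∃ φ : (Fin m → F) →ₗ[F] F,
      ∀ x, (interleave S (C x))[p.val]? = some (φ x) := fun p => by
    rcases interleave_getElem? (F := F) S p p.2 with ⟨i, -, h⟩ | h
    · exact ⟨LinearMap.proj i ∘ₗ C, fun x => h (C x)⟩
    · exact ⟨0, fun x => h (C x)⟩
  choose φ hφ using key
  refine ⟨LinearMap.pi φ, fun x => List.ext_getElem? fun p => ?_⟩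
  rcases lt_or_ge p (blockLength S) with h | h
  · rw [hφ ⟨p, h⟩]; simp [h]
  · rw [List.getElem?_eq_none (by simpa using h), List.getElem?_eq_none (by simpa using h)]

/-- A decoder that corrects `k` insertions and deletions forces the edit distance `2 * k + 1`. -/
lemma CorrectsInsdels.le_editDist {m k : ℕ} {enc : (Fin m → F) → List F} {dec : List F → Fin m → F}
    (h : CorrectsInsdels k enc dec) {x x' : Fin m → F} (hx : x ≠ x') :
    2 * k + 1 ≤ editDist (enc x) (enc x') := by
  by_contra hlt
  obtain ⟨z, h1, h2⟩ := exists_editDist_le_of_le_two_mul (k := k)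
    (x := enc x) (y := enc x') (by omega)
  exact hx ((h x z h1).symm.trans (h x' z h2))

end Encoding

/-! ### Alignments of the template with the received word -/

/-- `T q i φ` reads: the symbol at position `q` of the received word originates from blank `i` of
the template, and `φ` symbols have been deleted from or inserted into the two strings before this
place. Positions and blanks are counted from `1`, and `T 0 0 0` stands for the beginning of both
strings. The conditions say that `T` is functional and monotone, that there are at most `κ` edits,
and that distances are preserved where no edit takes place. -/
structure IsAlignment {N : ℕ} (S : Fin N → ℕ) (κ : ℕ) (T : ℕ → ℕ → ℕ → Prop) : Prop where
  zero : T 0 0 0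
  blank_le : ∀ {q i φ}, T q i φ → i ≤ N
  edits_le : ∀ {q i φ}, T q i φ → φ ≤ κ
  unique : ∀ {q i φ i' φ'}, T q i φ → T q i' φ' → i = i' ∧ φ = φ'
  blank_lt : ∀ {q i φ q' i' φ'}, T q i φ → T q' i' φ' → q < q' → i < i'
  edits_mono : ∀ {q i φ q' i' φ'}, T q i φ → T q' i' φ' → q < q' → φ ≤ φ'
  gap_eq : ∀ {q i φ q' i'}, T q i φ → T q' i' φ → q < q' →
    q + prefixPos S i' = q' + prefixPos S i

lemma costFrom_cons {N l : ℕ} (S : Fin N → ℕ) (p q : ℕ) (b : Fin N × Fin l)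
    (w : List (Fin N × Fin l)) :
    costFrom S p q (b :: w) =
      (if prefixPos S (b.1 + 1) + q = b.2 + 1 + p then 0 else 1) +
        costFrom S (prefixPos S (b.1 + 1)) (b.2 + 1) w := by
  rw [costFrom, blankPos_eq_prefixPos]
  congr 1
  refine if_congr ?_ rfl rfl
  omega

/-- The true matching pays at most once for each edit. -/
lemma IsAlignment.costFrom_add_le {N l κ : ℕ} {S : Fin N → ℕ} {T : ℕ → ℕ → ℕ → Prop}
    (hT : IsAlignment S κ T) (w : List (Fin N × Fin l)) :
    ∀ U Q φ : ℕ, T Q U φ → w.Pairwise (fun b b' => b.2 < b'.2) → (∀ b ∈ w, Q < b.2 + 1) →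
      (∀ b ∈ w, ∃ φ', T (b.2 + 1) (b.1 + 1) φ') →
      costFrom S (prefixPos S U) Q w + φ ≤ κ := by
  induction w with
  | nil => intro U Q φ h _ _ _; simpa [costFrom] using hT.edits_le h
  | cons b w ih =>
    intro U Q φ h hw hQ hb
    obtain ⟨φ', h'⟩ := hb b (by simp)
    rw [List.pairwise_cons] at hw
    have := ih _ _ _ h' hw.2 (fun c hc => by have := Fin.lt_def.1 (hw.1 c hc); omega)
      fun c hc => hb c (by simp [hc])
    have hφ := hT.edits_mono h h' (hQ b (by simp))
    rw [costFrom_cons]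
    split_ifs with hc
    · omega
    · rcases hφ.lt_or_eq with hlt | rfl
      · omega
      · have := hT.gap_eq h h' (hQ b (by simp)); omega

/-- The pair `b` matches a symbol to a blank from which it does not originate. -/
def IsBad {N l : ℕ} (T : ℕ → ℕ → ℕ → Prop) (b : Fin N × Fin l) : Prop :=
  ¬ ∃ φ, T (b.2 + 1) (b.1 + 1) φ

/-- The pair `b` matches a symbol that originates from no blank. -/
def IsForeign {N l : ℕ} (T : ℕ → ℕ → ℕ → Prop) (b : Fin N × Fin l) : Prop :=
  ¬ ∃ i φ, T (b.2 + 1) i φ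

open scoped Classical in
/-- A bad pair of a matching either pays, or is accounted for by an edit, or is preceded by a pair
from which it has the same distance in the template as the two true blanks have, so that two
different gaps of the template coincide. The start `(U, Q)` stands for the preceding pair, and `φ₀`
for the number of edits before it. -/
lemma IsAlignment.countP_isBad_add_le {N l κ : ℕ} {S : Fin N → ℕ} {T : ℕ → ℕ → ℕ → Prop}
    (hT : IsAlignment S κ T) (w : List (Fin N × Fin l)) :
    ∀ U Q φ₀ : ℕ, φ₀ ≤ κ → (∀ q i φ, Q < q → T q i φ → φ₀ ≤ φ) → (∀ i φ, T Q i φ → φ = φ₀) →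
      w.Pairwise (fun b b' => b.1 < b'.1 ∧ b.2 < b'.2) → (∀ b ∈ w, U < b.1 + 1 ∧ Q < b.2 + 1) →
      ∃ ev : List GapPair, ev.Pairwise GapPair.Before ∧
        (∀ g ∈ ev, g.Proper N ∧ g.Coincides S ∧ U ≤ g.u ∧ ∀ q i φ, q ≤ Q → T q i φ → i ≤ g.u') ∧
        w.countP (IsBad T ·) + φ₀ ≤ ev.length + costFrom S (prefixPos S U) Q w +
          2 * w.countP (IsForeign T ·) + (if ∃ i φ, T Q i φ then 0 else 1) + κ := by
  induction w with
  | nil => intro U Q φ₀ h0 _ _ _ _; exact ⟨[], by simp, by simp, by simp; omega⟩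
  | cons b w ih =>
    intro U Q φ₀ h0 hge hle hw hlt
    rw [List.pairwise_cons] at hw
    obtain ⟨hbU, hbQ⟩ := hlt b (by simp)
    have hlt' : ∀ c ∈ w, b.1.val + 1 < c.1 + 1 ∧ b.2.val + 1 < c.2 + 1 := fun c hc => by
      have := hw.1 c hc; rw [Fin.lt_def, Fin.lt_def] at this; omega
    rw [List.countP_cons, List.countP_cons, costFrom_cons]
    by_cases hfor : IsForeign T b
    · have hbad : IsBad T b := fun ⟨φ, h⟩ => hfor ⟨_, φ, h⟩
      obtain ⟨ev, h1, h2, h3⟩ := ih (b.1 + 1) (b.2 + 1) φ₀ h0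
        (fun q i φ hq h => hge q i φ (by omega) h) (fun i φ h => absurd ⟨i, φ, h⟩ hfor) hw.2 hlt'
      refine ⟨ev, h1, fun g hg => ?_, ?_⟩
      · obtain ⟨a1, a2, a3, a4⟩ := h2 g hg
        exact ⟨a1, a2, by omega, fun q i φ hq h => a4 q i φ (by omega) h⟩
      · simp only [hfor, hbad, decide_true, if_true]
        have h4 : ¬ ∃ i φ, T (b.2 + 1) i φ := hfor
        rw [if_neg h4] at h3
        omega
    · obtain ⟨i₁, φ₁, hb⟩ := not_not.1 hfor
      have hφ₁ : φ₀ ≤ φ₁ := hge _ _ _ hbQ hb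
      obtain ⟨ev, h1, h2, h3⟩ := ih (b.1 + 1) (b.2 + 1) φ₁ (hT.edits_le hb)
        (fun q i φ hq h => hT.edits_mono hb h hq) (fun i φ h => (hT.unique h hb).2) hw.2 hlt'
      rw [if_pos ⟨i₁, φ₁, hb⟩] at h3
      have h2' : ∀ g ∈ ev, g.Proper N ∧ g.Coincides S ∧ U ≤ g.u ∧
          ∀ q i φ, q ≤ Q → T q i φ → i ≤ g.u' := fun g hg => by
        obtain ⟨a1, a2, a3, a4⟩ := h2 g hg
        exact ⟨a1, a2, by omega, fun q i φ hq h => a4 q i φ (by omega) h⟩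
      simp only [hfor, decide_false, Bool.false_eq_true, if_false]
      by_cases hbad : IsBad T b
      swap
      · refine ⟨ev, h1, h2', ?_⟩
        simp only [hbad, decide_false, Bool.false_eq_true, if_false]
        omega
      simp only [hbad, decide_true, if_true]
      have hne : b.1.val + 1 ≠ i₁ := fun h => hbad ⟨φ₁, h ▸ hb⟩
      by_cases hQ : ∃ i φ, T Q i φ
      swap
      · exact ⟨ev, h1, h2', by rw [if_neg hQ]; omega⟩
      rw [if_pos hQ]
      obtain ⟨i₀, φ, hQ⟩ := hQ
      by_cases hc : prefixPos S (b.1 + 1) + Q = b.2 + 1 + prefixPos S U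
      swap
      · exact ⟨ev, h1, h2', by rw [if_neg hc]; omega⟩
      by_cases hφ : φ = φ₁
      swap
      · have := hle _ _ hQ
        have := hT.edits_mono hQ hb hbQ
        exact ⟨ev, h1, h2', by rw [if_pos hc]; omega⟩
      subst hφ
      have hgap := hT.gap_eq hQ hb hbQ
      have hi := hT.blank_lt hQ hb hbQ
      refine ⟨⟨U, b.1 + 1, i₀, i₁⟩ :: ev, List.pairwise_cons.2 ⟨fun g hg => ?_, h1⟩, ?_, ?_⟩
      · obtain ⟨⟨b1, b2, -⟩, -, a3, a4⟩ := h2 g hg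
        have := a4 _ _ _ le_rfl hb
        refine ⟨?_, ?_, ?_, ?_⟩ <;> simp only <;> omega
      · intro g hg
        rcases List.mem_cons.1 hg with rfl | hg
        · refine ⟨⟨hbU, hi, hne, b.1.2, hT.blank_le hb⟩, ?_, le_rfl, fun q i φ' hq h => ?_⟩
          · simp only [GapPair.Coincides]; omega
          · rcases hq.lt_or_eq with hq | rfl
            · exact (hT.blank_lt h hQ hq).le
            · exact (hT.unique h hQ).1.le
        · exact h2' g hg
      · rw [if_pos hc, List.length_cons]
        omega

lemma hasCoincidences_of_pairwise {N t : ℕ} {S : Fin N → ℕ} {ev : List GapPair}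
    (h1 : ev.Pairwise GapPair.Before) (h2 : ∀ g ∈ ev, g.Proper N ∧ g.Coincides S)
    (ht : t ≤ ev.length) : HasCoincidences S t :=
  ⟨fun k => ev.get (k.castLE ht), fun _ => (h2 _ (List.get_mem _ _)).1,
    fun _ _ hkl => List.pairwise_iff_get.1 h1 _ _ hkl, fun _ => (h2 _ (List.get_mem _ _)).2⟩

lemma strictMono_fin_add_le {m n : ℕ} {f : Fin m → Fin n} (hf : StrictMono f) {r s : Fin m}
    (h : r ≤ s) : (f r).val + s ≤ f s + r := by
  obtain ⟨s, hs⟩ := s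
  rw [Fin.le_def] at h
  simp only at h
  induction s, h using Nat.le_induction with
  | base => exact le_rfl
  | succ s h ih =>
    have h1 := ih (by omega)
    have h2 : f ⟨s, by omega⟩ < f ⟨s + 1, hs⟩ := hf (Fin.lt_def.2 (Nat.lt_succ_self s))
    rw [Fin.lt_def] at h2
    simp only at h1 ⊢
    omega

lemma strictMono_fin_le {m n : ℕ} {f : Fin m → Fin n} (hf : StrictMono f) (r : Fin m) :
    r.val ≤ f r := by
  have := strictMono_fin_add_le hf (r := ⟨0, r.pos⟩) (s := r) (Fin.le_def.2 (Nat.zero_le _))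
  simp only at this; omega

lemma strictMono_fin_add_card_le {m n : ℕ} {f : Fin m → Fin n} (hf : StrictMono f) (r : Fin m) :
    (f r).val + m ≤ n + r := by
  have hm := r.pos
  have := strictMono_fin_add_le hf (r := r) (s := ⟨m - 1, by omega⟩)
    (Fin.le_def.2 (Nat.le_sub_one_of_lt r.2))
  have := (f ⟨m - 1, by omega⟩).2
  simp only at *; omega

/-! ### The true matching -/

section Matching

variable {F : Type*} {N : ℕ}

lemma IsMatching.nodup_fst [Zero F] {z : List F} {w : List (Fin N × Fin z.length)}
    (h : IsMatching z w) : (w.map Prod.fst).Nodup :=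
  List.pairwise_map.2 (h.1.imp fun hb => hb.1.ne)

lemma IsMatching.nodup_snd [Zero F] {z : List F} {w : List (Fin N × Fin z.length)}
    (h : IsMatching z w) : (w.map Prod.snd).Nodup :=
  List.pairwise_map.2 (h.1.imp fun hb => hb.2.ne)

lemma IsMatching.fill_eq [Zero F] {z : List F} {w : List (Fin N × Fin z.length)}
    (h : IsMatching z w) {b : Fin N × Fin z.length} (hb : b ∈ w) : fill z w b.1 = z.get b.2 := by
  unfold fill
  cases hf : w.find? (fun b' => b'.1 = b.1) with
  | none => simpa using List.find?_eq_none.1 hf b hb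
  | some b' =>
    have h1 : b'.1 = b.1 := by simpa using List.find?_some hf
    rw [List.inj_on_of_nodup_map h.nodup_fst (List.mem_of_find?_eq_some hf) hb h1]

lemma fill_eq_zero [Zero F] {z : List F} {w : List (Fin N × Fin z.length)} {i : Fin N}
    (h : ∀ b ∈ w, b.1 ≠ i) : fill z w i = 0 := by
  unfold fill
  rw [List.find?_eq_none.2 (by simpa using fun a b hb => h (a, b) hb)]

lemma countP_eq_length_filter_finRange {σ : Type*} (p : σ → Bool) (l : List σ) :
    l.countP p = ((List.finRange l.length).filter fun r => p (l.get r)).length := by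
  conv_lhs => rw [← List.map_get_finRange l, List.countP_map]
  rw [List.countP_eq_length_filter]; rfl

lemma IsMatching.length_le [Zero F] [DecidableEq F] {z : List F}
    {w : List (Fin N × Fin z.length)} (h : IsMatching z w) : w.length ≤ z.countP (· ≠ 0) := by
  rw [countP_eq_length_filter_finRange, ← List.length_map (f := Prod.snd)]
  refine (h.nodup_snd.subperm fun t ht => ?_).length_le
  obtain ⟨b, hb, rfl⟩ := List.mem_map.1 ht
  exact List.mem_filter.2 ⟨List.mem_finRange _, decide_eq_true (h.2 b hb)⟩

open scoped Classical in
/-- After at most `κ` edits, `d` deletions and `e` insertions say, the symbols that are left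
untouched give an alignment and a matching that misses at most `d` non-zero symbols of `y` and at
most `e` non-zero symbols of `z`. -/
lemma exists_isAlignment [Zero F] [DecidableEq F] {S : Fin N → ℕ} {y : Fin N → F} {z : List F}
    {κ : ℕ}
    (h : editDist (interleave S y) z ≤ κ) :
    ∃ (T : ℕ → ℕ → ℕ → Prop) (w : List (Fin N × Fin z.length)) (d e : ℕ), d + e ≤ κ ∧
      IsAlignment S κ T ∧
      (∀ (i : Fin N) (t : Fin z.length) (φ : ℕ), T (t + 1) (i + 1) φ → z.get t = y i ∧ y i ≠ 0) ∧
      IsMatching z w ∧ (∀ b ∈ w, ∃ φ, T (b.2 + 1) (b.1 + 1) φ) ∧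
      (Finset.univ.filter fun i => y i ≠ 0).card ≤ w.length + d ∧
      z.countP (· ≠ 0) ≤ w.length + e ∧
      ∀ w' : List (Fin N × Fin z.length), IsMatching z w' → w'.countP (IsForeign T ·) ≤ e := by
  obtain ⟨l, hlx, hlz, hlen⟩ := (editSteps_editDist (interleave S y) z).exists_common_sublist
  set x := interleave S y with hx
  have hxn : x.length = blockLength S := length_interleave S y
  obtain ⟨f, hf⟩ := List.sublist_iff_exists_fin_orderEmbedding_get_eq.1 hlx
  obtain ⟨g, hg⟩ := List.sublist_iff_exists_fin_orderEmbedding_get_eq.1 hlz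
  have hfm := f.strictMono
  have hgm := g.strictMono
  -- the blank from which a non-zero common symbol originates
  have hidx : ∀ r : Fin l.length, ∃ i : Fin N, l.get r ≠ 0 →
      prefixPos S (i + 1) = (f r).val + 1 ∧ y i = l.get r := by
    intro r
    have hN : 0 < N := by
      rcases Nat.eq_zero_or_pos N with rfl | hN
      · have := (f r).2.trans_eq hxn; simp [blockLength] at this
      · exact hN
    rcases interleave_getElem? (F := F) S (f r) (hxn ▸ (f r).2) with ⟨i, h1, h2⟩ | h2
    · refine ⟨i, fun _ => ⟨h1, ?_⟩⟩
      have := h2 y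
      rw [← hx, List.getElem?_eq_getElem (f r).2, Option.some_inj] at this
      rw [hf, ← this]; rfl
    · refine ⟨⟨0, hN⟩, fun h0 => absurd ?_ h0⟩
      have := h2 y
      rw [← hx, List.getElem?_eq_getElem (f r).2, Option.some_inj] at this
      rw [hf, ← this]; rfl
  choose idx hidx using hidx
  have hidxm : ∀ r r', l.get r ≠ 0 → l.get r' ≠ 0 → r < r' → idx r < idx r' := by
    intro r r' h1 h2 hlt
    have h3 := Fin.lt_def.1 (hfm hlt)
    by_contra hle
    have := prefixPos_mono S (show (idx r').val + 1 ≤ idx r + 1 by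
      rw [not_lt, Fin.le_def] at hle; omega)
    rw [(hidx r h1).1, (hidx r' h2).1] at this
    omega
  set R := (List.finRange l.length).filter fun r => l.get r ≠ 0 with hR
  have hRlen : R.length = l.countP (· ≠ 0) := by
    rw [countP_eq_length_filter_finRange]
  have hRmem : ∀ r ∈ R, l.get r ≠ 0 := fun r hr => by simpa using (List.mem_filter.1 hr).2
  have hRlt : R.Pairwise (· < ·) := (List.pairwise_lt_finRange _).filter _
  have hlx' := hlx.length_le
  have hlz' := hlz.length_le
  refine ⟨fun q i φ => (q = 0 ∧ i = 0 ∧ φ = 0) ∨ ∃ r, l.get r ≠ 0 ∧ q = (g r).val + 1 ∧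
      i = (idx r).val + 1 ∧ φ = (f r).val + g r - 2 * r,
    R.map fun r => (idx r, g r), x.length - l.length, z.length - l.length, by omega, ?_, ?_, ?_, ?_,
    ?_, ?_, ?_⟩
  · constructor
    · exact .inl ⟨rfl, rfl, rfl⟩
    · rintro q i φ (⟨-, rfl, -⟩ | ⟨r, -, -, rfl, -⟩)
      · exact Nat.zero_le _
      · exact (idx r).2
    · rintro q i φ (⟨-, -, rfl⟩ | ⟨r, -, -, -, rfl⟩)
      · exact Nat.zero_le _
      · have := strictMono_fin_add_card_le hfm r
        have := strictMono_fin_add_card_le hgm r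
        omega
    · rintro q i φ i' φ' (⟨h1, rfl, rfl⟩ | ⟨r, -, h1, rfl, rfl⟩)
        (⟨h2, rfl, rfl⟩ | ⟨r', -, h2, rfl, rfl⟩)
      · exact ⟨rfl, rfl⟩
      · omega
      · omega
      · obtain rfl : r = r' := g.injective (Fin.ext (by omega))
        exact ⟨rfl, rfl⟩
    · rintro q i φ q' i' φ' (⟨h1, rfl, rfl⟩ | ⟨r, hr, h1, rfl, rfl⟩)
        (⟨h2, rfl, rfl⟩ | ⟨r', hr', h2, rfl, rfl⟩) hq
      · omega
      · omega
      · omega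
      · have := Fin.lt_def.1 (hidxm r r' hr hr' (hgm.lt_iff_lt.1 (Fin.lt_def.2 (by omega))))
        omega
    · rintro q i φ q' i' φ' (⟨h1, rfl, rfl⟩ | ⟨r, hr, h1, rfl, rfl⟩)
        (⟨h2, rfl, rfl⟩ | ⟨r', hr', h2, rfl, rfl⟩) hq
      · omega
      · omega
      · omega
      · have hlt : r ≤ r' := (hgm.lt_iff_lt.1 (Fin.lt_def.2 (by omega))).le
        have := strictMono_fin_add_le hfm hlt
        have := strictMono_fin_add_le hgm hlt
        omega
    · rintro q i φ q' i' (⟨h1, rfl, rfl⟩ | ⟨r, hr, h1, rfl, rfl⟩)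
        (⟨h2, rfl, h3⟩ | ⟨r', hr', h2, rfl, h3⟩) hq
      · omega
      · rw [(hidx r' hr').1, prefixPos_zero]
        have := strictMono_fin_le hfm r'
        have := strictMono_fin_le hgm r'
        omega
      · omega
      · rw [(hidx r' hr').1, (hidx r hr).1]
        have hlt : r ≤ r' := (hgm.lt_iff_lt.1 (Fin.lt_def.2 (by omega))).le
        have := strictMono_fin_add_le hfm hlt
        have := strictMono_fin_add_le hgm hlt
        have := strictMono_fin_le hfm r
        have := strictMono_fin_le hgm r
        have := strictMono_fin_le hfm r'
        have := strictMono_fin_le hgm r'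
        omega
  · rintro i t φ (⟨h1, -⟩ | ⟨r, hr, h1, h2, -⟩)
    · omega
    · obtain rfl : t = g r := Fin.ext (by omega)
      obtain rfl : i = idx r := Fin.ext (by omega)
      rw [(hidx r hr).2, ← hg]
      exact ⟨rfl, hr⟩
  · refine ⟨List.pairwise_map.2 (hRlt.imp_of_mem fun hr hr' hlt =>
      ⟨hidxm _ _ (hRmem _ hr) (hRmem _ hr') hlt, hgm hlt⟩), fun b hb => ?_⟩
    obtain ⟨r, hr, rfl⟩ := List.mem_map.1 hb
    simp only [← hg]; exact hRmem r hr
  · intro b hb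
    obtain ⟨r, hr, rfl⟩ := List.mem_map.1 hb
    exact ⟨_, .inr ⟨r, hRmem r hr, rfl, rfl, rfl⟩⟩
  · rw [← countP_interleave S y, ← hx, List.length_map, hRlen]
    have := hlx.le_countP (· ≠ 0)
    omega
  · rw [List.length_map, hRlen]
    have := hlz.le_countP (· ≠ 0)
    omega
  · intro w' hw'
    rw [List.countP_eq_length_filter, ← List.length_map (f := Prod.snd),
      ← List.toFinset_card_of_nodup
        (hw'.nodup_snd.sublist (List.filter_sublist.map Prod.snd))]
    have hcard : (Finset.univ \ Finset.univ.image g).card = z.length - l.length := by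
      rw [Finset.card_sdiff_of_subset (Finset.subset_univ _),
        Finset.card_image_of_injective _ g.injective]
      simp
    rw [← hcard]
    refine Finset.card_le_card fun t ht => ?_
    obtain ⟨b, hb, rfl⟩ := List.mem_map.1 (List.mem_toFinset.1 ht)
    obtain ⟨hb, hfor⟩ := List.mem_filter.1 hb
    simp only [Finset.mem_sdiff, Finset.mem_univ, true_and, Finset.mem_image, not_exists]
    intro r hr
    refine of_decide_eq_true hfor ⟨_, _, .inr ⟨r, ?_, by rw [hr], rfl, rfl⟩⟩
    rw [hg, hr]; exact hw'.2 b hb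

/-! ### Correctness of optimal matchings -/

open scoped Classical in
/-- Good pairs fill their blank correctly, so that wrong symbols come from bad pairs and from
non-zero blanks without a good pair. -/
lemma hammingDist_fill_add_length_le [Zero F] [DecidableEq F] {T : ℕ → ℕ → ℕ → Prop}
    {y : Fin N → F} {z : List F}
    (hT : ∀ (i : Fin N) (t : Fin z.length) (φ : ℕ), T (t + 1) (i + 1) φ → z.get t = y i ∧ y i ≠ 0)
    {w : List (Fin N × Fin z.length)} (hw : IsMatching z w) :
    hammingDist y (fill z w) + w.length ≤
      (Finset.univ.filter fun i => y i ≠ 0).card + 2 * w.countP (IsBad T ·) := by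
  set B := ((w.filter (IsBad T ·)).map Prod.fst).toFinset with hB
  set G := ((w.filter (¬ IsBad T ·)).map Prod.fst).toFinset with hG
  have hBcard : B.card ≤ w.countP (IsBad T ·) := by
    rw [List.countP_eq_length_filter, ← List.length_map (f := Prod.fst)]
    exact List.toFinset_card_le _
  have hGcard : w.length = w.countP (IsBad T ·) + G.card := by
    rw [hG, List.toFinset_card_of_nodup
      (hw.nodup_fst.sublist (List.filter_sublist.map Prod.fst)), List.length_map,
      ← List.countP_eq_length_filter, List.length_eq_countP_add_countP (IsBad T ·)]
    simp
  have hGood : ∀ b ∈ w, ¬ IsBad T b → z.get b.2 = y b.1 ∧ y b.1 ≠ 0 := fun b _ hb => by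
    obtain ⟨φ, h⟩ := not_not.1 hb
    exact hT _ _ _ h
  have hGsub : G ⊆ Finset.univ.filter fun i => y i ≠ 0 := fun i hi => by
    obtain ⟨b, hb, rfl⟩ := List.mem_map.1 (List.mem_toFinset.1 hi)
    obtain ⟨hb, hbad⟩ := List.mem_filter.1 hb
    exact Finset.mem_filter.2 ⟨Finset.mem_univ _, (hGood b hb (of_decide_eq_true hbad)).2⟩
  have hsub : (Finset.univ.filter fun i => y i ≠ fill z w i) ⊆
      ((Finset.univ.filter fun i => y i ≠ 0) \ G) ∪ B := by
    intro i hi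
    have hi : y i ≠ fill z w i := by simpa using hi
    by_cases hmem : ∃ b ∈ w, b.1 = i
    · obtain ⟨b, hb, rfl⟩ := hmem
      refine Finset.mem_union_right _ (List.mem_toFinset.2 (List.mem_map.2
        ⟨b, List.mem_filter.2 ⟨hb, decide_eq_true ?_⟩, rfl⟩))
      by_contra hbad
      exact hi (by rw [hw.fill_eq hb, (hGood b hb hbad).1])
    · refine Finset.mem_union_left _ (Finset.mem_sdiff.2 ⟨?_, fun hiG => hmem ?_⟩)
      · rw [fill_eq_zero fun b hb h => hmem ⟨b, hb, h⟩] at hi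
        simpa using hi
      · obtain ⟨b, hb, rfl⟩ := List.mem_map.1 (List.mem_toFinset.1 hiG)
        exact ⟨b, (List.mem_filter.1 hb).1, rfl⟩
  have h1 := (Finset.card_le_card hsub).trans (Finset.card_union_le _ _)
  rw [Finset.card_sdiff_of_subset hGsub] at h1
  have h2 := Finset.card_le_card hGsub
  have h3 : hammingDist y (fill z w) = (Finset.univ.filter fun i => y i ≠ fill z w i).card := rfl
  omega

/-- Unless `κ + 1` pairs of gaps coincide, every optimal matching recovers the codeword up to
`14 * κ` symbols. -/
lemma IsOptimalMatching.hammingDist_fill_le [Zero F] [DecidableEq F] {S : Fin N → ℕ} {y : Fin N → F}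
    {z : List F} {κ : ℕ} (h : editDist (interleave S y) z ≤ κ) (hS : ¬ HasCoincidences S (κ + 1))
    {w : List (Fin N × Fin z.length)} (hw : IsOptimalMatching S z w) :
    hammingDist y (fill z w) ≤ 14 * κ := by
  classical
  obtain ⟨T, w₀, d, e, hde, hT, hsymb, hw₀, hgood, hy, hz, hfor⟩ := exists_isAlignment h
  have hcost : cost S w₀ ≤ κ := by
    have := hT.costFrom_add_le w₀ 0 0 0 hT.zero (hw₀.1.imp fun h => h.2) (by simp) hgood
    simpa [cost] using this
  have hopt := hw.2 w₀ hw₀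
  unfold obj at hopt
  have hlen := hw.1.length_le
  obtain ⟨ev, h1, h2, h3⟩ := hT.countP_isBad_add_le w 0 0 0 (Nat.zero_le _)
    (fun _ _ _ _ _ => Nat.zero_le _) (fun i φ h => (hT.unique h hT.zero).2) hw.1.1 (by simp)
  rw [if_pos ⟨0, 0, hT.zero⟩, prefixPos_zero] at h3
  have hev : ev.length ≤ κ := by
    by_contra hlt
    exact hS (hasCoincidences_of_pairwise h1 (fun g hg => ⟨(h2 g hg).1, (h2 g hg).2.1⟩) (by omega))
  have hham := hammingDist_fill_add_length_le hsymb hw.1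
  have hfor' := hfor w hw.1
  change _ ≤ ev.length + cost S w + _ + _ + _ at h3
  omega

end Matching

/-! ### The table of optimal continuations -/

section Table

/-- The gain of a match of blank `i'` to position `j'` that follows a match of blank `i` to position
`j`: it is `1` if the two distances agree. Blank `i` sits at position `pr i`. -/
def gain (pr : ℕ → ℕ) (i j i' j' : ℕ) : ℕ := if pr i' + j = j' + pr i then 1 else 0

/-- The entry `(i, j)` of a table is correct as far as the candidates in `R` are concerned. Here
`V i j` is the best objective of a matching that follows a match of blank `i` to position `j`, and
`(nI i j, nJ i j)` is the first match of an optimal continuation, where `nI i j = 0` means that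
there is none. The symbols of the received word are `zr 0, …, zr (L - 1)`. -/
def EntryCorrect (N L : ℕ) (pr zr : ℕ → ℕ) (V nI nJ : ℕ → ℕ → ℕ) (R : ℕ → ℕ → Prop)
    (i j : ℕ) : Prop :=
  (∀ i' j', i < i' → i' ≤ N → j < j' → j' ≤ L → zr (j' - 1) ≠ 0 → R i' j' →
    gain pr i j i' j' + V i' j' ≤ V i j) ∧
  ((nI i j = 0 ∧ V i j = 0) ∨
    (i < nI i j ∧ nI i j ≤ N ∧ j < nJ i j ∧ nJ i j ≤ L ∧ zr (nJ i j - 1) ≠ 0 ∧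
      gain pr i j (nI i j) (nJ i j) + V (nI i j) (nJ i j) = V i j))

/-- The entries from `(i, j)` on, in lexicographic order, are correct. -/
def CorrectFrom (N L : ℕ) (pr zr : ℕ → ℕ) (V nI nJ : ℕ → ℕ → ℕ) (i j : ℕ) : Prop :=
  ∀ i₀ j₀, i₀ ≤ N → j₀ ≤ L → i < i₀ ∨ (i₀ = i ∧ j ≤ j₀) →
    EntryCorrect N L pr zr V nI nJ (fun _ _ => True) i₀ j₀

/-- The entries before `(i, j)`, in lexicographic order, are still untouched. -/
def ZeroBefore (V nI : ℕ → ℕ → ℕ) (i j : ℕ) : Prop :=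
  ∀ i₀ j₀, i₀ < i ∨ (i₀ = i ∧ j₀ < j) → V i₀ j₀ = 0 ∧ nI i₀ j₀ = 0

/-- The state of the table while entry `(i, j)` is computed and `(i', j')` is the next candidate. -/
def PartiallyFilled (N L : ℕ) (pr zr : ℕ → ℕ) (V nI nJ : ℕ → ℕ → ℕ) (i j i' j' : ℕ) : Prop :=
  CorrectFrom N L pr zr V nI nJ i (j + 1) ∧ ZeroBefore V nI i j ∧
    EntryCorrect N L pr zr V nI nJ (fun i₀ j₀ => i₀ < i' ∨ (i₀ = i' ∧ j₀ < j')) i j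

variable {N L : ℕ} {pr zr : ℕ → ℕ} {V nI nJ : ℕ → ℕ → ℕ} {i j i' j' : ℕ}

lemma PartiallyFilled.start (h : CorrectFrom N L pr zr V nI nJ i (j + 1))
    (h0 : ZeroBefore V nI i (j + 1)) : PartiallyFilled N L pr zr V nI nJ i j (i + 1) (j + 1) := by
  refine ⟨h, fun i₀ j₀ h' => h0 i₀ j₀ (by omega), fun i' j' h1 h2 h3 h4 h5 h6 => by omega, .inl ?_⟩
  exact (h0 i j (by omega)).symm

lemma PartiallyFilled.next_row (h : PartiallyFilled N L pr zr V nI nJ i j i' (L + 1)) :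
    PartiallyFilled N L pr zr V nI nJ i j (i' + 1) (j + 1) :=
  ⟨h.1, h.2.1, fun a b h1 h2 h3 h4 h5 h6 => h.2.2.1 a b h1 h2 h3 h4 h5 (by omega), h.2.2.2⟩

lemma PartiallyFilled.finish (h : PartiallyFilled N L pr zr V nI nJ i j (N + 1) j') :
    CorrectFrom N L pr zr V nI nJ i j ∧ ZeroBefore V nI i j := by
  refine ⟨fun i₀ j₀ hi hj h' => ?_, h.2.1⟩
  by_cases heq : i₀ = i ∧ j₀ = j
  · obtain ⟨rfl, rfl⟩ := heq
    exact ⟨fun a b h1 h2 h3 h4 h5 _ => h.2.2.1 a b h1 h2 h3 h4 h5 (by omega), h.2.2.2⟩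
  · exact h.1 i₀ j₀ hi hj (by omega)

lemma PartiallyFilled.skip (h : PartiallyFilled N L pr zr V nI nJ i j i' j')
    (hc : zr (j' - 1) ≠ 0 → gain pr i j i' j' + V i' j' ≤ V i j) :
    PartiallyFilled N L pr zr V nI nJ i j i' (j' + 1) := by
  refine ⟨h.1, h.2.1, fun a b h1 h2 h3 h4 h5 h6 => ?_, h.2.2.2⟩
  by_cases heq : a = i' ∧ b = j'
  · obtain ⟨rfl, rfl⟩ := heq; exact hc h5
  · exact h.2.2.1 a b h1 h2 h3 h4 h5 (by omega)

/-- The table `V` with entry `(i, j)` replaced by `v`. -/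
def updateEntry (V : ℕ → ℕ → ℕ) (i j v : ℕ) : ℕ → ℕ → ℕ :=
  fun a b => if a = i ∧ b = j then v else V a b

lemma updateEntry_same (V : ℕ → ℕ → ℕ) (i j v : ℕ) : updateEntry V i j v i j = v := by
  simp [updateEntry]

lemma updateEntry_of_ne (V : ℕ → ℕ → ℕ) {i j a b : ℕ} (v : ℕ) (h : ¬ (a = i ∧ b = j)) :
    updateEntry V i j v a b = V a b := by
  simp [updateEntry, h]

lemma PartiallyFilled.improve (h : PartiallyFilled N L pr zr V nI nJ i j i' j')
    (hi : i < i') (hi' : i' ≤ N) (hj : j < j') (hj' : j' ≤ L) (hz : zr (j' - 1) ≠ 0)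
    (hc : V i j < gain pr i j i' j' + V i' j') :
    PartiallyFilled N L pr zr (updateEntry V i j (gain pr i j i' j' + V i' j'))
      (updateEntry nI i j i') (updateEntry nJ i j j') i j i' (j' + 1) := by
  refine ⟨fun i₀ j₀ h1 h2 h3 => ?_, fun i₀ j₀ h1 => ?_, fun a b h1 h2 h3 h4 h5 h6 => ?_, .inr ?_⟩
  · obtain ⟨hub, hatt⟩ := h.1 i₀ j₀ h1 h2 h3
    have hne : ¬ (i₀ = i ∧ j₀ = j) := by omega
    refine ⟨fun a b a1 a2 a3 a4 a5 a6 => ?_, ?_⟩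
    · rw [updateEntry_of_ne _ _ hne, updateEntry_of_ne _ _ (by omega)]
      exact hub a b a1 a2 a3 a4 a5 a6
    · rw [updateEntry_of_ne nI _ hne, updateEntry_of_ne nJ _ hne, updateEntry_of_ne V _ hne]
      rcases hatt with hatt | hatt
      · exact .inl hatt
      · refine .inr ?_
        rw [updateEntry_of_ne V _ (by omega)]
        exact hatt
  · have hne : ¬ (i₀ = i ∧ j₀ = j) := by omega
    rw [updateEntry_of_ne _ _ hne, updateEntry_of_ne _ _ hne]
    exact h.2.1 i₀ j₀ h1
  · rw [updateEntry_same, updateEntry_of_ne _ _ (by omega)]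
    by_cases heq : a = i' ∧ b = j'
    · obtain ⟨rfl, rfl⟩ := heq; exact le_rfl
    · exact (h.2.2.1 a b h1 h2 h3 h4 h5 (by omega)).trans hc.le
  · rw [updateEntry_same, updateEntry_same, updateEntry_same, updateEntry_of_ne _ _ (by omega)]
    exact ⟨hi, hi', hj, hj', hz, rfl⟩

end Table

/-! ### Optimal matchings from a correct table -/

section TableMatching

variable {F : Type*} [Zero F] {N : ℕ} {S : Fin N → ℕ} {z : List F} {pr zr : ℕ → ℕ}
  {V nI nJ : ℕ → ℕ → ℕ}

/-- The matches of `w` are those found by following the pointers from `(i, j)`. -/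
def Follows {N l : ℕ} (nI nJ : ℕ → ℕ → ℕ) : ℕ → ℕ → List (Fin N × Fin l) → Prop
  | i, j, [] => nI i j = 0
  | i, j, b :: w => nI i j = b.1 + 1 ∧ nJ i j = b.2 + 1 ∧ Follows nI nJ (b.1 + 1) (b.2 + 1) w

lemma costFrom_cons_gain {l : ℕ} (hpr : ∀ u ≤ N, pr u = prefixPos S u) {i j : ℕ} (hi : i ≤ N)
    (b : Fin N × Fin l) (w : List (Fin N × Fin l)) :
    costFrom S (prefixPos S i) j (b :: w) + gain pr i j (b.1 + 1) (b.2 + 1) =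
      1 + costFrom S (prefixPos S (b.1 + 1)) (b.2 + 1) w := by
  rw [costFrom_cons, gain, hpr _ hi, hpr _ b.1.2]
  split_ifs <;> omega

lemma CorrectFrom.length_le (hpr : ∀ u ≤ N, pr u = prefixPos S u)
    (hzr : ∀ t : Fin z.length, z.get t ≠ 0 → zr t ≠ 0)
    (hV : CorrectFrom N z.length pr zr V nI nJ 0 0) (w : List (Fin N × Fin z.length)) :
    ∀ i j : ℕ, i ≤ N → j ≤ z.length → IsMatching z w →
      (∀ b ∈ w, i < b.1 + 1 ∧ j < b.2 + 1) →
      w.length ≤ V i j + costFrom S (prefixPos S i) j w := by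
  induction w with
  | nil => intros; exact Nat.zero_le _
  | cons b w ih =>
    intro i j hi hj hw hlt
    obtain ⟨h1, h2⟩ := hlt b (by simp)
    have hw1 := List.pairwise_cons.1 hw.1
    have ih := ih (b.1 + 1) (b.2 + 1) b.1.2 b.2.2 ⟨hw1.2, fun c hc => hw.2 c (by simp [hc])⟩
      fun c hc => by have := hw1.1 c hc; rw [Fin.lt_def, Fin.lt_def] at this; omega
    have hub := (hV i j hi hj (by omega)).1 (b.1 + 1) (b.2 + 1) h1 b.1.2 h2 b.2.2
      (hzr b.2 (hw.2 b (by simp))) trivial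
    have := costFrom_cons_gain hpr (j := j) hi b w
    rw [List.length_cons]
    omega

lemma CorrectFrom.exists_follows (hpr : ∀ u ≤ N, pr u = prefixPos S u)
    (hzr : ∀ t : Fin z.length, zr t ≠ 0 → z.get t ≠ 0)
    (hV : CorrectFrom N z.length pr zr V nI nJ 0 0) :
    ∀ k i j : ℕ, N - i = k → i ≤ N → j ≤ z.length → ∃ w : List (Fin N × Fin z.length),
      IsMatching z w ∧ (∀ b ∈ w, i < b.1 + 1 ∧ j < b.2 + 1) ∧ Follows nI nJ i j w ∧
      w.length = V i j + costFrom S (prefixPos S i) j w := by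
  intro k
  induction k using Nat.strong_induction_on with
  | _ k ih =>
    intro i j hk hi hj
    rcases (hV i j hi hj (by omega)).2 with ⟨h1, h2⟩ | ⟨h1, h2, h3, h4, h5, h6⟩
    · exact ⟨[], ⟨by simp, by simp⟩, by simp, h1, by simp [h2, costFrom]⟩
    · obtain ⟨w, hw, hlt, hf, hlen⟩ := ih (N - nI i j) (by omega) (nI i j) (nJ i j) rfl h2 h4
      set b : Fin N × Fin z.length := (⟨nI i j - 1, by omega⟩, ⟨nJ i j - 1, by omega⟩) with hb
      have hb1 : b.1.val + 1 = nI i j := by simp only [hb]; omega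
      have hb2 : b.2.val + 1 = nJ i j := by simp only [hb]; omega
      rw [← hb1, ← hb2] at hf hlen hlt h6
      refine ⟨b :: w, ⟨List.pairwise_cons.2 ⟨fun c hc => ?_, hw.1⟩, fun c hc => ?_⟩, fun c hc => ?_,
        ⟨hb1.symm, hb2.symm, hf⟩, ?_⟩
      · have := hlt c hc
        rw [Fin.lt_def, Fin.lt_def]; omega
      · rcases List.mem_cons.1 hc with rfl | hc
        · exact hzr _ h5
        · exact hw.2 c hc
      · rcases List.mem_cons.1 hc with rfl | hc
        · omega
        · have := hlt c hc; omega
      · have := costFrom_cons_gain hpr (j := j) hi b w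
        rw [List.length_cons]
        omega

/-- The pointers of a correct table lead to an optimal matching. -/
lemma CorrectFrom.exists_isOptimalMatching (hpr : ∀ u ≤ N, pr u = prefixPos S u)
    (hzr : ∀ t : Fin z.length, zr t ≠ 0 ↔ z.get t ≠ 0)
    (hV : CorrectFrom N z.length pr zr V nI nJ 0 0) :
    ∃ w : List (Fin N × Fin z.length), IsOptimalMatching S z w ∧ Follows nI nJ 0 0 w := by
  obtain ⟨w, hw, -, hf, hlen⟩ := hV.exists_follows hpr (fun t => (hzr t).1) N 0 0 (by omega)
    (Nat.zero_le _) (Nat.zero_le _)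
  refine ⟨w, ⟨hw, fun w' hw' => ?_⟩, hf⟩
  have h := hV.length_le hpr (fun t => (hzr t).2) w' 0 0 (Nat.zero_le _) (Nat.zero_le _) hw'
    (by simp)
  rw [prefixPos_zero] at h hlen
  unfold obj cost
  omega

end TableMatching

/-! ### Step-counting rules for programs -/

/-- `M.set r i v` stores `v` in column `i` of row `r`. -/
def Memory.set (M : Memory) (r i v : ℕ) : Memory :=
  Function.update M r (Function.update (M r) i v)

lemma Memory.set_row_of_ne (M : Memory) {r s : ℕ} (i v : ℕ) (h : s ≠ r) : M.set r i v s = M s :=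
  Function.update_of_ne h _ _

lemma Memory.set_same (M : Memory) (r i v : ℕ) : M.set r i v r i = v := by
  simp [Memory.set]

lemma Memory.set_col_of_ne (M : Memory) (r : ℕ) {i j : ℕ} (v : ℕ) (h : j ≠ i) :
    M.set r i v r j = M r j := by
  simp [Memory.set, h]

/-- The table whose `i`-th line is row `k + 3 * i` of the memory. Three tables are interleaved. -/
def Memory.tab (M : Memory) (k i j : ℕ) : ℕ := M (k + (i + (i + i))) j

lemma Memory.tab_set_of_lt (M : Memory) {k r : ℕ} (c v : ℕ) (h : r < k) :
    (M.set r c v).tab k = M.tab k := by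
  funext i j
  rw [tab, set_row_of_ne _ _ _ (by omega)]; rfl

lemma Memory.tab_set_same (M : Memory) (k i j v : ℕ) :
    (M.set (k + (i + (i + i))) j v).tab k = updateEntry (M.tab k) i j v := by
  funext a b
  by_cases ha : a = i
  · subst ha
    by_cases hb : b = j
    · subst hb; rw [updateEntry_same, tab, set_same]
    · rw [updateEntry_of_ne _ _ (by omega), tab, set_col_of_ne _ _ _ hb]; rfl
  · rw [updateEntry_of_ne _ _ (by omega), tab, set_row_of_ne _ _ _ (by omega)]; rfl

lemma Memory.tab_set_other (M : Memory) {k l : ℕ} (i j v : ℕ) (h : k ≠ l) (hk : k < l + 3)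
    (hl : l < k + 3) : (M.set (k + (i + (i + i))) j v).tab l = M.tab l := by
  funext a b
  rw [tab, set_row_of_ne _ _ _ (by omega)]; rfl

/-- Started on `M`, the program `c` halts within `b` steps on a memory that satisfies `Q`. -/
def Exec (A : (ℕ → ℕ) → ℕ → ℕ) (T : ℕ) (c : RamProg) (M : Memory) (b : ℕ) (Q : Memory → Prop) :
    Prop :=
  ∃ M' t, Runs A T c M M' t ∧ t ≤ b ∧ Q M'

section Exec

variable {A : (ℕ → ℕ) → ℕ → ℕ} {T : ℕ} {c d : RamProg} {e f r i : RamExpr} {M : Memory}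
  {b b' : ℕ} {Q Q' : Memory → Prop}

lemma Exec.mono (h : Exec A T c M b Q) (hb : b ≤ b') (hQ : ∀ M', Q M' → Q' M') :
    Exec A T c M b' Q' := by
  obtain ⟨M', t, h1, h2, h3⟩ := h
  exact ⟨M', t, h1, h2.trans hb, hQ _ h3⟩

lemma exec_write (h : Q (M.set (r.eval M) (i.eval M) (e.eval M))) :
    Exec A T (.write r i e) M (r.size + i.size + e.size + 1) Q :=
  ⟨_, _, .write r i e M, le_rfl, h⟩

lemma Exec.seq (h : Exec A T c M b fun M' => Exec A T d M' b' Q) :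
    Exec A T (.seq c d) M (b + b') Q := by
  obtain ⟨M', t, h1, h2, M'', t', h3, h4, h5⟩ := h
  exact ⟨M'', _, .seq h1 h3, by omega, h5⟩

lemma exec_write_seq (h : Exec A T d (M.set (r.eval M) (i.eval M) (e.eval M)) b Q) :
    Exec A T (.seq (.write r i e) d) M (r.size + i.size + e.size + 1 + b) Q :=
  Exec.seq (exec_write h)

lemma exec_cond (h : e.eval M < f.eval M → Exec A T c M b Q)
    (h' : ¬ e.eval M < f.eval M → Exec A T d M b Q) :
    Exec A T (.cond e f c d) M (e.size + f.size + 1 + b) Q := by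
  by_cases hef : e.eval M < f.eval M
  · obtain ⟨M', t, h1, h2, h3⟩ := h hef
    exact ⟨M', _, .condTrue hef h1, by omega, h3⟩
  · obtain ⟨M', t, h1, h2, h3⟩ := h' hef
    exact ⟨M', _, .condFalse hef h1, by omega, h3⟩

lemma exec_loop_end (hef : ¬ e.eval M < f.eval M) (h : Q M) :
    Exec A T (.loop e f c) M (e.size + f.size + 1) Q :=
  ⟨M, _, .loopEnd hef, le_rfl, h⟩

lemma exec_loop_step (hef : e.eval M < f.eval M)
    (h : Exec A T c M b fun M' => Exec A T (.loop e f c) M' b' Q) :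
    Exec A T (.loop e f c) M (e.size + f.size + 1 + b + b') Q := by
  obtain ⟨M', t, h1, h2, M'', t', h3, h4, h5⟩ := h
  exact ⟨M'', _, .loopStep hef h1 h3, by omega, h5⟩

/-- The rule for loops, with an invariant `I` and a variant `μ`. -/
lemma exec_loop (I : Memory → Prop) (μ : Memory → ℕ)
    (hstep : ∀ M, I M → e.eval M < f.eval M → Exec A T c M b fun M' => I M' ∧ μ M' < μ M)
    (hM : I M) (hend : ∀ M, I M → ¬ e.eval M < f.eval M → Q M) :
    Exec A T (.loop e f c) M (μ M * (e.size + f.size + 1 + b) + (e.size + f.size + 1)) Q := by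
  induction hn : μ M using Nat.strong_induction_on generalizing M with
  | _ n ih =>
    by_cases hef : e.eval M < f.eval M
    · refine (exec_loop_step (b' := (n - 1) * (e.size + f.size + 1 + b) + (e.size + f.size + 1)) hef
        ((hstep M hM hef).mono le_rfl fun M' h => ?_)).mono ?_ fun _ h => h
      · refine (ih _ (hn ▸ h.2) h.1 rfl).mono ?_ fun _ h => h
        have : μ M' ≤ n - 1 := by omega
        gcongr
      · have hn1 : 1 ≤ n := by have := hstep M hM hef; obtain ⟨_, _, _, _, _, h⟩ := this; omega
        obtain ⟨n, rfl⟩ := Nat.exists_eq_add_of_le' hn1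
        simp only [Nat.add_sub_cancel, add_mul]
        omega
    · exact (exec_loop_end hef (hend M hM hef)).mono (by omega) fun _ h => h

end Exec

/-! ### The decoding program -/

section Program

/-- The scalar in column `k` of row `0`. -/
abbrev scalar (k : ℕ) : RamExpr := .cell (.const 0) (.const k)

/-- Entry `(e, f)` of table `k`. -/
abbrev entry (k : ℕ) (e f : RamExpr) : RamExpr := .cell (.add (.const k) (.add e (.add e e))) f

/-- Store `e` in column `k` of row `0`. -/
abbrev setScalar (k : ℕ) (e : RamExpr) : RamProg := .write (.const 0) (.const k) e

/-- Store `g` in entry `(e, f)` of table `k`. -/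
abbrev setEntry (k : ℕ) (e f g : RamExpr) : RamProg :=
  .write (.add (.const k) (.add e (.add e e))) f g

/-- Do nothing. -/
abbrev skipProg : RamProg := .loop (.const 0) (.const 0) .call

/-- Row `5` receives the positions of the blanks; scalar `2` counts the blanks. -/
def prefixProg : RamProg :=
  .loop (scalar 2) (scalar 0) (.seq
    (.write (.const 5) (.add (scalar 2) (.const 1))
      (.add (.cell (.const 5) (scalar 2)) (.add (.cell (.const 1) (scalar 2)) (.const 1))))
    (setScalar 2 (.add (scalar 2) (.const 1))))

/-- The value of the candidate `(i', j')` for the entry `(i, j)`; the numbers `i`, `j`, `i'`, `j'`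
are the scalars `2`, `3`, `4`, `5`. The equality of the two distances is tested by
`1 - ((x - y) + (y - x))`. -/
def candidateExpr : RamExpr :=
  .add
    (.sub (.const 1) (.add
      (.sub (.add (.cell (.const 5) (scalar 4)) (scalar 3))
        (.add (scalar 5) (.cell (.const 5) (scalar 2))))
      (.sub (.add (scalar 5) (.cell (.const 5) (scalar 2)))
        (.add (.cell (.const 5) (scalar 4)) (scalar 3)))))
    (entry 6 (scalar 4) (scalar 5))

/-- The entry `(i, j)` is improved by the candidate `(i', j')` if possible. -/
def improveProg : RamProg :=
  .cond (.const 0) (.cell (.const 2) (.sub (scalar 5) (.const 1)))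
    (.cond (entry 6 (scalar 2) (scalar 3)) candidateExpr
      (.seq (setEntry 6 (scalar 2) (scalar 3) candidateExpr)
        (.seq (setEntry 7 (scalar 2) (scalar 3) (scalar 4))
          (setEntry 8 (scalar 2) (scalar 3) (scalar 5))))
      skipProg)
    skipProg

/-- All candidates in line `i'`. -/
def lineProg : RamProg :=
  .loop (scalar 5) (.add (scalar 1) (.const 1))
    (.seq improveProg (setScalar 5 (.add (scalar 5) (.const 1))))

/-- All candidates for the entry `(i, j)`. -/
def entryProg : RamProg :=
  .loop (scalar 4) (.add (scalar 0) (.const 1))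
    (.seq (setScalar 5 (.add (scalar 3) (.const 1)))
      (.seq lineProg (setScalar 4 (.add (scalar 4) (.const 1)))))

/-- The entries `(i, L), …, (i, 0)`. -/
def rowProg : RamProg :=
  .loop (.const 0) (scalar 3)
    (.seq (setScalar 3 (.sub (scalar 3) (.const 1)))
      (.seq (setScalar 4 (.add (scalar 2) (.const 1))) entryProg))

/-- The table of optimal continuations, with values in table `6` and pointers in tables `7`, `8`. -/
def tableProg : RamProg :=
  .loop (.const 0) (scalar 2)
    (.seq (setScalar 2 (.sub (scalar 2) (.const 1)))
      (.seq (setScalar 3 (.add (scalar 1) (.const 1))) rowProg))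

/-- The blanks are filled in row `3` along the pointers. -/
def walkProg : RamProg :=
  .loop (.const 0) (entry 7 (scalar 2) (scalar 3))
    (.seq (setScalar 4 (entry 7 (scalar 2) (scalar 3)))
      (.seq (setScalar 5 (entry 8 (scalar 2) (scalar 3)))
        (.seq (setScalar 2 (scalar 4))
          (.seq (setScalar 3 (scalar 5))
            (.write (.const 3) (.sub (scalar 2) (.const 1))
              (.cell (.const 2) (.sub (scalar 3) (.const 1))))))))

/-- The decoder: an optimal matching is computed and applied, and the subroutine is called. -/
def decoderProg : RamProg :=
  .seq prefixProg
    (.seq (setScalar 2 (.add (scalar 0) (.const 1)))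
      (.seq tableProg
        (.seq (setScalar 2 (.const 0))
          (.seq (setScalar 3 (.const 0))
            (.seq walkProg .call)))))

end Program

/-! ### Correctness of the table computation -/

section ProgramCorrectness

variable {A : (ℕ → ℕ) → ℕ → ℕ} {T N L : ℕ} {pr zr : ℕ → ℕ} {M : Memory}

/-- The part of the memory that stays fixed while the table is computed. -/
structure TableState (N L : ℕ) (pr zr : ℕ → ℕ) (M : Memory) : Prop where
  numBlanks : M 0 0 = N
  length : M 0 1 = L
  word : M 2 = zr
  output : M 3 = fun _ => 0
  pos : M 5 = pr

lemma TableState.setScalar (h : TableState N L pr zr M) {k : ℕ} (hk : 2 ≤ k) (v : ℕ) :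
    TableState N L pr zr (M.set 0 k v) where
  numBlanks := by rw [M.set_col_of_ne _ _ (by omega), h.numBlanks]
  length := by rw [M.set_col_of_ne _ _ (by omega), h.length]
  word := by rw [M.set_row_of_ne _ _ (by omega), h.word]
  output := by rw [M.set_row_of_ne _ _ (by omega), h.output]
  pos := by rw [M.set_row_of_ne _ _ (by omega), h.pos]

lemma TableState.setRow (h : TableState N L pr zr M) {r : ℕ} (hr : 6 ≤ r) (c v : ℕ) :
    TableState N L pr zr (M.set r c v) where
  numBlanks := by rw [M.set_row_of_ne _ _ (by omega), h.numBlanks]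
  length := by rw [M.set_row_of_ne _ _ (by omega), h.length]
  word := by rw [M.set_row_of_ne _ _ (by omega), h.word]
  output := by rw [M.set_row_of_ne _ _ (by omega), h.output]
  pos := by rw [M.set_row_of_ne _ _ (by omega), h.pos]

/-- The invariant of the table computation while entry `(i, j)` is computed and `(i', j')` is the
next candidate. -/
def TableInv (N L : ℕ) (pr zr : ℕ → ℕ) (i j i' j' : ℕ) (M : Memory) : Prop :=
  TableState N L pr zr M ∧ PartiallyFilled N L pr zr (M.tab 6) (M.tab 7) (M.tab 8) i j i' j'

/-- The invariant of the table computation before entry `(i, j - 1)` is computed. -/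
def EntryInv (N L : ℕ) (pr zr : ℕ → ℕ) (i j : ℕ) (M : Memory) : Prop :=
  TableState N L pr zr M ∧ CorrectFrom N L pr zr (M.tab 6) (M.tab 7) (M.tab 8) i j ∧
    ZeroBefore (M.tab 6) (M.tab 7) i j

lemma TableInv.setScalar {i j i' j' : ℕ} (h : TableInv N L pr zr i j i' j' M) {k : ℕ} (hk : 2 ≤ k)
    (v : ℕ) : TableInv N L pr zr i j i' j' (M.set 0 k v) := by
  refine ⟨h.1.setScalar hk v, ?_⟩
  rw [M.tab_set_of_lt _ _ (by omega), M.tab_set_of_lt _ _ (by omega),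
    M.tab_set_of_lt _ _ (by omega)]
  exact h.2

lemma EntryInv.setScalar {i j : ℕ} (h : EntryInv N L pr zr i j M) {k : ℕ} (hk : 2 ≤ k)
    (v : ℕ) : EntryInv N L pr zr i j (M.set 0 k v) := by
  refine ⟨h.1.setScalar hk v, ?_⟩
  rw [M.tab_set_of_lt _ _ (by omega), M.tab_set_of_lt _ _ (by omega),
    M.tab_set_of_lt _ _ (by omega)]
  exact h.2

lemma eval_candidateExpr (M : Memory) :
    candidateExpr.eval M =
      gain (M 5) (M 0 2) (M 0 3) (M 0 4) (M 0 5) + M.tab 6 (M 0 4) (M 0 5) := by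
  simp only [candidateExpr, RamExpr.eval, gain, Memory.tab]
  split_ifs <;> omega

/-- The constants in the step bounds of this and the following loops are rounded up. -/
lemma exec_improveProg {i j i' j' : ℕ} (h : TableInv N L pr zr i j i' j' M) (h2 : M 0 2 = i)
    (h3 : M 0 3 = j) (h4 : M 0 4 = i') (h5 : M 0 5 = j') (hi : i < i') (hi' : i' ≤ N)
    (hj : j < j') (hj' : j' ≤ L) :
    Exec A T improveProg M 300 fun M' => TableInv N L pr zr i j i' (j' + 1) M' ∧ M' 0 = M 0 := by
  obtain ⟨hst, hpf⟩ := h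
  have hskip : ∀ (hc : zr (j' - 1) ≠ 0 → gain pr i j i' j' + M.tab 6 i' j' ≤ M.tab 6 i j),
      Exec A T skipProg M 3 fun M' => TableInv N L pr zr i j i' (j' + 1) M' ∧ M' 0 = M 0 :=
    fun hc => exec_loop_end (lt_irrefl _) ⟨⟨hst, hpf.skip hc⟩, rfl⟩
  refine (exec_cond (b := 290) (fun hz => ?_) fun hz => (hskip ?_).mono (by decide)
    fun _ h => h).mono (by decide) fun _ h => h
  swap
  · simp only [RamExpr.eval, h5, hst.word] at hz
    omega
  refine (exec_cond (b := 150) (fun hc => ?_) fun hc => (hskip fun _ => ?_).mono (by decide)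
    fun _ h => h).mono (by decide) fun _ h => h
  swap
  · rw [eval_candidateExpr] at hc
    simp only [RamExpr.eval, h2, h3, h4, h5, hst.pos, not_lt] at hc
    exact hc
  simp only [RamExpr.eval, h5, hst.word] at hz
  have hcand : candidateExpr.eval M = gain pr i j i' j' + M.tab 6 i' j' := by
    rw [eval_candidateExpr, h2, h3, h4, h5, hst.pos]
  rw [hcand] at hc
  simp only [RamExpr.eval, h2, h3] at hc
  have hnew := hpf.improve hi hi' hj hj' (by omega) hc
  refine Exec.mono (exec_write_seq (exec_write_seq (exec_write ?_))) (by decide) fun _ h => h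
  rw [hcand]
  simp only [RamExpr.eval, h2, h3]
  set M₁ := M.set (6 + (i + (i + i))) j (gain pr i j i' j' + M.tab 6 i' j') with hM₁
  have hr1 : M₁ 0 = M 0 := M.set_row_of_ne _ _ (by omega)
  simp only [hr1, h2, h3, h4]
  set M₂ := M₁.set (7 + (i + (i + i))) j i' with hM₂
  have hr2 : M₂ 0 = M 0 := (M₁.set_row_of_ne _ _ (by omega)).trans hr1
  simp only [hr2, h2, h3, h5]
  refine ⟨⟨((hst.setRow (by omega) _ _).setRow (by omega) _ _).setRow (by omega) _ _, ?_⟩,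
    (M₂.set_row_of_ne _ _ (by omega)).trans hr2⟩
  rw [M₂.tab_set_same, M₂.tab_set_other _ _ _ (by omega) (by omega) (by omega),
    M₂.tab_set_other _ _ _ (by omega) (by omega) (by omega), hM₂, M₁.tab_set_same,
    M₁.tab_set_other _ _ _ (by omega) (by omega) (by omega),
    M₁.tab_set_other _ _ _ (by omega) (by omega) (by omega), hM₁, M.tab_set_same,
    M.tab_set_other _ _ _ (by omega) (by omega) (by omega),
    M.tab_set_other _ _ _ (by omega) (by omega) (by omega)]
  exact hnew

lemma exec_lineProg {i j i' : ℕ} (h : TableInv N L pr zr i j i' (j + 1) M) (h2 : M 0 2 = i)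
    (h3 : M 0 3 = j) (h4 : M 0 4 = i') (h5 : M 0 5 = j + 1) (hi : i < i') (hi' : i' ≤ N)
    (hj : j ≤ L) :
    Exec A T lineProg M (400 * (L + 1)) fun M' =>
      TableInv N L pr zr i j (i' + 1) (j + 1) M' ∧ M' 0 2 = i ∧ M' 0 3 = j ∧ M' 0 4 = i' := by
  refine (exec_loop (b := 320) (fun M => TableInv N L pr zr i j i' (M 0 5) M ∧ M 0 2 = i ∧
    M 0 3 = j ∧ M 0 4 = i' ∧ j < M 0 5 ∧ M 0 5 ≤ L + 1) (fun M => L + 1 - M 0 5) ?_ ?_ ?_).mono ?_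
    fun _ h => h
  · rintro M ⟨h, h2, h3, h4, h5, h6⟩ hg
    simp only [RamExpr.eval, h.1.length] at hg
    refine (Exec.seq ((exec_improveProg h h2 h3 h4 rfl hi hi' h5 (by omega)).mono le_rfl
      fun M' hM' => exec_write ?_)).mono (by decide) fun _ h => h
    obtain ⟨hM', hrow⟩ := hM'
    simp only [RamExpr.eval, hrow]
    have hs : M'.set 0 5 (M 0 5 + 1) 0 5 = M 0 5 + 1 := M'.set_same _ _ _
    rw [hs]
    refine ⟨⟨hM'.setScalar (by omega) _, ?_, ?_, ?_, by omega, by omega⟩, by omega⟩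
    all_goals rw [M'.set_col_of_ne _ _ (by omega), hrow]; assumption
  · exact ⟨h5 ▸ h, h2, h3, h4, by omega, by omega⟩
  · rintro M ⟨h, h2, h3, h4, h5, h6⟩ hg
    simp only [RamExpr.eval, h.1.length] at hg
    have h7 : M 0 5 = L + 1 := by omega
    rw [h7] at h
    exact ⟨⟨h.1, h.2.next_row⟩, h2, h3, h4⟩
  · simp only [RamExpr.size, h5]
    omega

lemma exec_entryProg {i j : ℕ} (h : TableInv N L pr zr i j (i + 1) (j + 1) M) (h2 : M 0 2 = i)
    (h3 : M 0 3 = j) (h4 : M 0 4 = i + 1) (hi : i ≤ N) (hj : j ≤ L) :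
    Exec A T entryProg M (500 * ((N + 1) * (L + 1))) fun M' =>
      EntryInv N L pr zr i j M' ∧ M' 0 2 = i ∧ M' 0 3 = j := by
  refine (exec_loop (b := 400 * (L + 1) + 20) (fun M => TableInv N L pr zr i j (M 0 4) (j + 1) M ∧
    M 0 2 = i ∧ M 0 3 = j ∧ i < M 0 4 ∧ M 0 4 ≤ N + 1) (fun M => N + 1 - M 0 4) ?_ ?_ ?_).mono ?_
    fun _ h => h
  · rintro M ⟨h, h2, h3, h4, h5⟩ hg
    simp only [RamExpr.eval, h.1.numBlanks] at hg
    refine (exec_write_seq (b := 400 * (L + 1) + 8) (Exec.seq ?_)).mono ?_ fun _ h => h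
    · simp only [RamExpr.eval, h3]
      refine (exec_lineProg (i' := M 0 4) (h.setScalar (by omega) _) ?_ ?_ ?_ ?_ h4 (by omega)
        hj).mono le_rfl fun M' hM' => exec_write ?_
      · rw [M.set_col_of_ne _ _ (by omega)]; exact h2
      · rw [M.set_col_of_ne _ _ (by omega)]; exact h3
      · rw [M.set_col_of_ne _ _ (by omega)]
      · exact M.set_same _ _ _
      · obtain ⟨a1, a2, a3, a4⟩ := hM'
        simp only [RamExpr.eval, a4]
        have hs : M'.set 0 4 (M 0 4 + 1) 0 4 = M 0 4 + 1 := M'.set_same _ _ _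
        rw [hs]
        refine ⟨⟨a1.setScalar (by omega) _, ?_, ?_, by omega, by omega⟩, by omega⟩
        all_goals rw [M'.set_col_of_ne _ _ (by omega)]; assumption
    · simp only [RamExpr.size]
      omega
  · exact ⟨h4 ▸ h, h2, h3, by omega, by omega⟩
  · rintro M ⟨h, h2, h3, h4, h5⟩ hg
    simp only [RamExpr.eval, h.1.numBlanks] at hg
    have h7 : M 0 4 = N + 1 := by omega
    rw [h7] at h
    have := h.2.finish
    exact ⟨⟨h.1, this⟩, h2, h3⟩
  · simp only [RamExpr.size, h4]
    have : N + 1 - (i + 1) + 1 ≤ N + 1 := by omega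
    nlinarith [Nat.mul_le_mul_right (500 * (L + 1)) this]

lemma exec_rowProg {i : ℕ} (h : EntryInv N L pr zr i (L + 1) M) (h2 : M 0 2 = i)
    (h3 : M 0 3 = L + 1) (hi : i ≤ N) :
    Exec A T rowProg M (600 * ((N + 1) * (L + 1) * (L + 1))) fun M' =>
      EntryInv N L pr zr i 0 M' ∧ M' 0 2 = i := by
  refine (exec_loop (b := 500 * ((N + 1) * (L + 1)) + 20) (fun M => EntryInv N L pr zr i (M 0 3) M ∧
    M 0 2 = i ∧ M 0 3 ≤ L + 1) (fun M => M 0 3) ?_ ?_ ?_).mono ?_ fun _ h => h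
  · rintro M ⟨h, h2, h3⟩ hg
    simp only [RamExpr.eval] at hg
    obtain ⟨j, hj⟩ := Nat.exists_eq_add_of_le' (show 1 ≤ M 0 3 from hg)
    rw [hj] at h h3
    refine (exec_write_seq (exec_write_seq (b := 500 * ((N + 1) * (L + 1))) ?_)).mono ?_
      fun _ h => h
    · simp only [RamExpr.eval, hj, Nat.add_sub_cancel]
      set M₁ := M.set 0 3 j with hM₁
      have e2 : M₁ 0 2 = i := by rw [hM₁, M.set_col_of_ne _ _ (by omega), h2]
      have e3 : M₁ 0 3 = j := M.set_same _ _ _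
      simp only [e2]
      have h1 := (h.setScalar (k := 3) (by omega) j).setScalar (k := 4) (by omega) (i + 1)
      refine (exec_entryProg ⟨h1.1, PartiallyFilled.start h1.2.1 h1.2.2⟩ ?_ ?_ (M₁.set_same _ _ _)
        hi (by omega)).mono le_rfl fun M' hM' => ?_
      · rw [M₁.set_col_of_ne _ _ (by omega), e2]
      · rw [M₁.set_col_of_ne _ _ (by omega), e3]
      · obtain ⟨a1, a2, a3⟩ := hM'
        rw [a3]
        exact ⟨⟨a1, a2, by omega⟩, by omega⟩
    · simp only [RamExpr.size]; omega
  · exact ⟨h3 ▸ h, h2, by omega⟩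
  · rintro M ⟨h, h2, h3⟩ hg
    simp only [RamExpr.eval] at hg
    have h7 : M 0 3 = 0 := by omega
    rw [h7] at h
    exact ⟨h, h2⟩
  · simp only [RamExpr.size, h3]
    have : L + 1 ≤ (N + 1) * (L + 1) * (L + 1) := Nat.le_mul_of_pos_left _ (by positivity)
    nlinarith

lemma exec_tableProg (h : TableState N L pr zr M) (h6 : ∀ i j, M.tab 6 i j = 0)
    (h7 : ∀ i j, M.tab 7 i j = 0) (h2 : M 0 2 = N + 1) :
    Exec A T tableProg M (700 * ((N + 1) * (N + 1) * ((L + 1) * (L + 1)))) fun M' =>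
      TableState N L pr zr M' ∧
        CorrectFrom N L pr zr (M'.tab 6) (M'.tab 7) (M'.tab 8) 0 0 := by
  refine (exec_loop (b := 600 * ((N + 1) * (L + 1) * (L + 1)) + 20)
    (fun M => EntryInv N L pr zr (M 0 2) 0 M ∧ M 0 2 ≤ N + 1) (fun M => M 0 2) ?_ ?_ ?_).mono ?_
    fun _ h => h
  · rintro M ⟨h, h2⟩ hg
    simp only [RamExpr.eval] at hg
    obtain ⟨i, hi⟩ := Nat.exists_eq_add_of_le' (show 1 ≤ M 0 2 from hg)
    rw [hi] at h h2
    have h' : EntryInv N L pr zr i (L + 1) M :=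
      ⟨h.1, fun a b h1 h2 h3 => h.2.1 a b h1 h2 (by omega), fun a b h1 => h.2.2 a b (by omega)⟩
    refine (exec_write_seq
      (exec_write_seq (b := 600 * ((N + 1) * (L + 1) * (L + 1))) ?_)).mono
      ?_ fun _ h => h
    · simp only [RamExpr.eval, hi, Nat.add_sub_cancel]
      set M₁ := M.set 0 2 i with hM₁
      have e1 : M₁ 0 1 = L := by rw [hM₁, M.set_col_of_ne _ _ (by omega), h.1.length]
      have e2 : M₁ 0 2 = i := M.set_same _ _ _
      simp only [e1]
      refine (exec_rowProg ((h'.setScalar (by omega) i).setScalar (by omega) (L + 1)) ?_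
        (M₁.set_same _ _ _) (by omega)).mono le_rfl fun M' hM' => ?_
      · rw [M₁.set_col_of_ne _ _ (by omega), e2]
      · obtain ⟨a1, a2⟩ := hM'
        rw [a2]
        exact ⟨⟨a1, by omega⟩, by omega⟩
    · simp only [RamExpr.size]; omega
  · rw [h2]
    exact ⟨⟨h, fun a b h1 _ h3 => by omega, fun a b _ => ⟨h6 a b, h7 a b⟩⟩, le_rfl⟩
  · rintro M ⟨h, h2⟩ hg
    simp only [RamExpr.eval] at hg
    have h7 : M 0 2 = 0 := by omega
    rw [h7] at h
    exact ⟨h.1, h.2.1⟩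
  · simp only [RamExpr.size, h2]
    have : N + 1 ≤ (N + 1) * ((N + 1) * (L + 1) * (L + 1)) :=
      Nat.le_mul_of_pos_right _ (by positivity)
    nlinarith

end ProgramCorrectness

/-! ### Correctness of the decoding program -/

section DecoderCorrectness

variable {A : (ℕ → ℕ) → ℕ → ℕ} {T N L : ℕ}

lemma exec_prefixProg {S : Fin N → ℕ} {sr zr : ℕ → ℕ} {M : Memory} (hsr : ∀ i : Fin N, sr i = S i)
    (h0 : M 0 0 = N) (h1 : M 0 1 = L) (h2 : M 0 2 = 0) (hM1 : M 1 = sr) (hM2 : M 2 = zr)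
    (hM3 : M 3 = fun _ => 0) (h5 : M 5 0 = 0) (h6 : ∀ r, 6 ≤ r → M r = fun _ => 0) :
    Exec A T prefixProg M (50 * (N + 1)) fun M' => (∃ pr : ℕ → ℕ,
      (∀ u ≤ N, pr u = prefixPos S u) ∧ TableState N L pr zr M') ∧
        ∀ r, 6 ≤ r → M' r = fun _ => 0 := by
  refine (exec_loop (b := 40) (fun M => M 0 0 = N ∧ M 0 1 = L ∧ M 1 = sr ∧ M 2 = zr ∧
    (M 3 = fun _ => 0) ∧ (∀ r, 6 ≤ r → M r = fun _ => 0) ∧ M 0 2 ≤ N ∧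
    ∀ u ≤ M 0 2, M 5 u = prefixPos S u) (fun M => N - M 0 2) ?_ ?_ ?_).mono ?_ fun _ h => h
  · rintro M ⟨h0, h1, hM1, hM2, hM3, h6, h2, h5⟩ hg
    simp only [RamExpr.eval, h0] at hg
    refine (exec_write_seq (exec_write ?_)).mono (by decide) fun _ h => h
    simp only [RamExpr.eval, hM1]
    set k := M 0 2 with hk
    set v := M 5 k + (sr k + 1) with hv
    set M₁ := M.set 5 (k + 1) v with hM₁
    have hrow : ∀ r, r ≠ 5 → M₁ r = M r := fun r hr => M.set_row_of_ne _ _ hr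
    rw [hrow 0 (by omega), ← hk]
    set M₂ := M₁.set 0 2 (k + 1) with hM₂
    have hrow' : ∀ r, r ≠ 5 → r ≠ 0 → M₂ r = M r := fun r hr hr' =>
      (M₁.set_row_of_ne _ _ hr').trans (hrow r hr)
    have hcol : ∀ c, c ≠ 2 → M₂ 0 c = M 0 c := fun c hc => by
      rw [hM₂, M₁.set_col_of_ne _ _ hc, hrow 0 (by omega)]
    have hk2 : M₂ 0 2 = k + 1 := M₁.set_same _ _ _
    refine ⟨⟨by rw [hcol 0 (by omega), h0], by rw [hcol 1 (by omega), h1],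
      by rw [hrow' 1 (by omega) (by omega), hM1], by rw [hrow' 2 (by omega) (by omega), hM2],
      by rw [hrow' 3 (by omega) (by omega), hM3],
      fun r hr => by rw [hrow' r (by omega) (by omega), h6 r hr], by omega, fun u hu => ?_⟩,
      by omega⟩
    have hrow5 : M₂ 5 = M₁ 5 := M₁.set_row_of_ne _ _ (by omega)
    rw [hrow5]
    rw [hk2] at hu
    rcases hu.lt_or_eq with hu | rfl
    · rw [hM₁, M.set_col_of_ne _ _ (by omega), h5 u (by omega)]
    · rw [hM₁, M.set_same, hv, h5 k le_rfl, hsr ⟨k, hg⟩]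
      exact (prefixPos_succ S ⟨k, hg⟩).symm
  · refine ⟨h0, h1, hM1, hM2, hM3, h6, by omega, fun u hu => ?_⟩
    obtain rfl : u = 0 := by omega
    rw [h5, prefixPos_zero]
  · rintro M ⟨h0, h1, hM1, hM2, hM3, h6, h2, h5⟩ hg
    simp only [RamExpr.eval, h0] at hg
    exact ⟨⟨M 5, fun u hu => h5 u (by omega), ⟨h0, h1, hM2, hM3, rfl⟩⟩, h6⟩
  · simp only [RamExpr.size, h2]; omega

lemma exec_walkProg {zr : ℕ → ℕ} {nI nJ : ℕ → ℕ → ℕ} (w : List (Fin N × Fin L)) :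
    ∀ (i j : ℕ) (M : Memory), M 0 2 = i → M 0 3 = j → M 2 = zr → M.tab 7 = nI → M.tab 8 = nJ →
      w.Pairwise (fun b b' => b.1 ≠ b'.1) → Follows nI nJ i j w →
      Exec A T walkProg M (100 * (w.length + 1)) fun M' => ∀ x : Fin N,
        M' 3 x = match w.find? (fun b => b.1 = x) with
          | some b => zr b.2
          | none => M 3 x := by
  induction w with
  | nil =>
    intro i j M h2 h3 hM2 h7 h8 _ hf
    refine (exec_loop_end ?_ fun x => rfl).mono ?_ fun _ h => h
    · have e7 : M (7 + (i + (i + i))) j = 0 := (congrFun (congrFun h7 i) j).trans hf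
      simp only [RamExpr.eval, h2, h3, e7, lt_irrefl, not_false_eq_true]
    · simp only [RamExpr.size]; omega
  | cons b w ih =>
    intro i j M h2 h3 hM2 h7 h8 hw hf
    obtain ⟨hI, hJ, hf⟩ := hf
    have e7 : M (7 + (i + (i + i))) j = b.1 + 1 := (congrFun (congrFun h7 i) j).trans hI
    have e8 : M (8 + (i + (i + i))) j = b.2 + 1 := (congrFun (congrFun h8 i) j).trans hJ
    have hw := List.pairwise_cons.1 hw
    refine (exec_loop_step (b' := 100 * (w.length + 1)) ?_ (exec_write_seq (exec_write_seq
      (exec_write_seq (exec_write_seq (exec_write ?_)))))).mono ?_ fun _ h => h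
    · simp only [RamExpr.eval, h2, h3, e7]; omega
    · simp only [RamExpr.eval, h2, h3, e7]
      set M₁ := M.set 0 4 (b.1 + 1) with hM₁
      have r1 : ∀ r, r ≠ 0 → M₁ r = M r := fun r hr => M.set_row_of_ne _ _ hr
      have c1 : M₁ 0 2 = i ∧ M₁ 0 3 = j ∧ M₁ 0 4 = b.1 + 1 :=
        ⟨by rw [hM₁, M.set_col_of_ne _ _ (by omega), h2],
          by rw [hM₁, M.set_col_of_ne _ _ (by omega), h3], M.set_same _ _ _⟩
      simp only [c1.1, c1.2.1, r1 (8 + (i + (i + i))) (by omega), e8]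
      set M₂ := M₁.set 0 5 (b.2 + 1) with hM₂
      have r2 : ∀ r, r ≠ 0 → M₂ r = M r := fun r hr => (M₁.set_row_of_ne _ _ hr).trans (r1 r hr)
      have c2 : M₂ 0 4 = b.1 + 1 ∧ M₂ 0 5 = b.2 + 1 :=
        ⟨by rw [hM₂, M₁.set_col_of_ne _ _ (by omega), c1.2.2], M₁.set_same _ _ _⟩
      simp only [c2.1]
      set M₃ := M₂.set 0 2 (b.1 + 1) with hM₃
      have r3 : ∀ r, r ≠ 0 → M₃ r = M r := fun r hr => (M₂.set_row_of_ne _ _ hr).trans (r2 r hr)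
      have c3 : M₃ 0 2 = b.1 + 1 ∧ M₃ 0 5 = b.2 + 1 :=
        ⟨M₂.set_same _ _ _, by rw [hM₃, M₂.set_col_of_ne _ _ (by omega), c2.2]⟩
      simp only [c3.2]
      set M₄ := M₃.set 0 3 (b.2 + 1) with hM₄
      have r4 : ∀ r, r ≠ 0 → M₄ r = M r := fun r hr => (M₃.set_row_of_ne _ _ hr).trans (r3 r hr)
      have c4 : M₄ 0 2 = b.1 + 1 ∧ M₄ 0 3 = b.2 + 1 :=
        ⟨by rw [hM₄, M₃.set_col_of_ne _ _ (by omega), c3.1], M₃.set_same _ _ _⟩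
      simp only [c4.1, c4.2, r4 2 (by omega), hM2, Nat.add_sub_cancel]
      set M₅ := M₄.set 3 b.1 (zr b.2) with hM₅
      have r5 : ∀ r, r ≠ 0 → r ≠ 3 → M₅ r = M r := fun r hr hr' =>
        (M₄.set_row_of_ne _ _ hr').trans (r4 r hr)
      have r50 : M₅ 0 = M₄ 0 := M₄.set_row_of_ne _ _ (by omega)
      have htab : ∀ k, 4 ≤ k → M₅.tab k = M.tab k := fun k hk => by
        funext a c; rw [Memory.tab, r5 _ (by omega) (by omega)]; rfl
      refine (ih (b.1 + 1) (b.2 + 1) M₅ (by rw [r50, c4.1]) (by rw [r50, c4.2])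
        (by rw [r5 2 (by omega) (by omega), hM2]) (by rw [htab 7 (by omega), h7])
        (by rw [htab 8 (by omega), h8]) hw.2 hf).mono le_rfl fun M' hM' x => ?_
      rw [hM' x, List.find?_cons]
      by_cases hx : b.1 = x
      · subst hx
        have hnone : w.find? (fun c => c.1 = b.1) = none := List.find?_eq_none.2 fun c hc => by
          simpa using (hw.1 c hc).symm
        simp only [hnone, decide_true]
        exact M₄.set_same _ _ _
      · have hM5x : M₅ 3 x = M 3 x := by
          rw [hM₅, M₄.set_col_of_ne _ _ fun h => hx (Fin.ext h.symm), r4 3 (by omega)]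
        simp only [hx, decide_false, hM5x]
    · simp only [RamExpr.size, List.length_cons]; omega

/-- The program finds an optimal matching and decodes the word filled in according to it. -/
lemma exists_decodesWithin {F : Type*} [Zero F] {m : ℕ} {label : F → ℕ}
    (hlabel : ∀ s, label s = 0 ↔ s = 0) {D : (Fin N → F) → Fin m → F}
    (hA : Implements label D A) (S : Fin N → ℕ) (z : List F) :
    ∃ w : List (Fin N × Fin z.length), IsOptimalMatching S z w ∧
      DecodesWithin label A T decoderProg S z (D (fill z w))
        (1000 * (blockLength S + z.length + 1) ^ 4 + T) := by
  set L := z.length with hL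
  set M₀ := initMemory label S z with hM₀
  have hzrt : ∀ t : Fin z.length, M₀ 2 t = label (z.get t) := fun t => by
    simp [hM₀, initMemory]
  have hsr : ∀ i : Fin N, M₀ 1 i = S i := fun i => by simp [hM₀, initMemory]
  have hM6 : ∀ r, 3 ≤ r → M₀ r = fun _ => 0 := fun r hr => by
    obtain ⟨r, rfl⟩ := Nat.exists_eq_add_of_le' hr
    rfl
  have hexec : Exec A T decoderProg M₀ (1000 * (blockLength S + z.length + 1) ^ 4 + T) fun M' =>
      ∃ w : List (Fin N × Fin z.length), IsOptimalMatching S z w ∧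
        ∀ k : Fin m, M' 4 k = label (D (fill z w) k) := by
    refine ((exec_prefixProg (L := L) hsr rfl rfl rfl rfl rfl (hM6 3 le_rfl)
      (congrFun (hM6 5 (by omega)) 0) fun r hr => hM6 r (by omega)).mono le_rfl
      fun M₁ hM₁ => ?_).seq.mono (b := 50 * (N + 1) + (8 +
        (700 * ((N + 1) * (N + 1) * ((L + 1) * (L + 1))) +
          (4 + (4 + (100 * (N + 1) + (T + 1))))))) ?_ fun _ h => h
    · obtain ⟨⟨pr, hpr, hst⟩, h6⟩ := hM₁
      refine (exec_write_seq (b := 700 * ((N + 1) * (N + 1) * ((L + 1) * (L + 1))) +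
        (4 + (4 + (100 * (N + 1) + (T + 1))))) (Exec.seq ?_)).mono ?_ fun _ h => h
      swap
      · simp only [RamExpr.size]; omega
      simp only [RamExpr.eval, hst.numBlanks]
      have htab : ∀ k, 6 ≤ k → ∀ i j, (M₁.set 0 2 (N + 1)).tab k i j = 0 := fun k hk i j => by
        rw [M₁.tab_set_of_lt _ _ (by omega), Memory.tab, h6 _ (by omega)]
      refine (exec_tableProg (hst.setScalar (by omega) _) (htab 6 (by omega)) (htab 7 (by omega))
        (M₁.set_same _ _ _)).mono le_rfl fun M₂ hM₂ => ?_
      obtain ⟨hst₂, hcorr⟩ := hM₂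
      obtain ⟨w, hw, hf⟩ := hcorr.exists_isOptimalMatching hpr
        fun t => by rw [hzrt]; exact (hlabel _).not
      have hwlen : w.length ≤ N := by
        simpa using hw.1.nodup_fst.length_le_card
      refine (exec_write_seq (b := 4 + (100 * (N + 1) + (T + 1))) (exec_write_seq
        (b := 100 * (N + 1) + (T + 1)) (Exec.seq ?_))).mono ?_ fun _ h => h
      swap
      · simp only [RamExpr.size]; omega
      simp only [RamExpr.eval]
      set M₃ := M₂.set 0 2 0 with hM₃
      have hst₃ : TableState N L pr (M₀ 2) M₃ := hst₂.setScalar (by omega) _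
      have hst₄ := hst₃.setScalar (k := 3) (by omega) 0
      refine (exec_walkProg w 0 0 (M₃.set 0 3 0) ?_ (M₃.set_same _ _ _) hst₄.word
        ?_ ?_ (hw.1.1.imp fun h => h.1.ne) hf).mono (by gcongr) fun M₄ hM₄ => ?_
      · rw [M₃.set_col_of_ne _ _ (by omega), hM₃, M₂.set_same]
      · rw [M₃.tab_set_of_lt _ _ (by omega), hM₃, M₂.tab_set_of_lt _ _ (by omega)]
      · rw [M₃.tab_set_of_lt _ _ (by omega), hM₃, M₂.tab_set_of_lt _ _ (by omega)]
      · refine ⟨_, _, .call M₄, le_rfl, w, hw, fun k => ?_⟩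
        rw [Function.update_self]
        refine hA _ _ (fun x => ?_) k
        rw [hM₄ x, hst₄.output]
        unfold fill
        cases w.find? fun b => decide (b.1 = x) with
        | some b => exact hzrt b.2
        | none => exact ((hlabel 0).2 rfl).symm
    · have hN : N ≤ blockLength S := Nat.le_add_right _ _
      set B := blockLength S + z.length + 1 with hB
      have hXY : (N + 1) * (L + 1) ≤ B ^ 2 := by
        have : N + L + 1 ≤ B := by omega
        calc (N + 1) * (L + 1) ≤ (N + L + 1) ^ 2 := by nlinarith
          _ ≤ B ^ 2 := Nat.pow_le_pow_left this 2
      have hX : (N + 1) * (N + 1) * ((L + 1) * (L + 1)) ≤ B ^ 4 := by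
        calc _ = ((N + 1) * (L + 1)) ^ 2 := by ring
          _ ≤ (B ^ 2) ^ 2 := Nat.pow_le_pow_left hXY 2
          _ = B ^ 4 := by ring
      have hN' : N + 1 ≤ B ^ 4 :=
        (show N + 1 ≤ B by omega).trans (Nat.le_self_pow (by omega) B)
      omega
  obtain ⟨M', t, hrun, ht, w, hw, hM'⟩ := hexec
  exact ⟨w, hw, M', t, hrun, ht, hM'⟩

end DecoderCorrectness

/-! ### Error correction -/

/-- Outside the coincidence event the optimal matchings correct all `κC / 100` edits. -/
lemma correctsInsdels_of_not_hasCoincidences {F : Type*} [Zero F] [DecidableEq F] {N m κC : ℕ}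
    {C : (Fin m → F) → Fin N → F} {D : (Fin N → F) → Fin m → F}
    (hD : ∀ (x : Fin m → F) (y : Fin N → F), hammingDist (C x) y ≤ κC → D y = x)
    {S : Fin N → ℕ} (hS : ¬ HasCoincidences S (κC / 100 + 1)) {dec : List F → Fin m → F}
    (hdec : ∀ z : List F, ∃ w : List (Fin N × Fin z.length),
      IsOptimalMatching S z w ∧ dec z = D (fill z w)) :
    CorrectsInsdels (κC / 100) (fun x => interleave S (C x)) dec := by
  intro x z hz
  obtain ⟨w, hw, h⟩ := hdec z
  rw [h]
  exact hD x _ ((hw.hammingDist_fill_le hz hS).trans (by omega))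

lemma measureReal_setOf_not_eq_zero {Ω : Type*} [MeasurableSpace Ω] {μ : Measure Ω} {p : Ω → Prop}
    (h : ∀ ω, p ω) : μ.real {ω | ¬ p ω} = 0 := by
  simp [h]

/-- The event that the code or its decoder fails has probability at most `2 ^ (-κC / 100)`. -/
lemma runLaw_real_failure_le {F : Type*} [Field F] [DecidableEq F] {N m κC a : ℕ}
    (hκ : 1 ≤ κC) (ha1 : 1 ≤ a) (ha : ((N : ℝ) / κC) ^ 45 ≤ a) (C : (Fin m → F) →ₗ[F] (Fin N → F))
    (hC : ∀ x x' : Fin m → F, x ≠ x' → 2 * κC + 1 ≤ hammingDist (C x) (C x'))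
    {D : (Fin N → F) → Fin m → F}
    (hD : ∀ (x : Fin m → F) (y : Fin N → F), hammingDist (C x) y ≤ κC → D y = x)
    {dec : (Fin N → ℕ) → List F → Fin m → F}
    (hdec : ∀ (S : Fin N → ℕ) (z : List F), ∃ w : List (Fin N × Fin z.length),
      IsOptimalMatching S z w ∧ dec S z = D (fill z w)) :
    (runLaw N a).real {S | ¬ (IsLinearInsdelCode (blockLength S) (2 * (κC / 100) + 1)
        (fun x => interleave S (C x)) ∧
      CorrectsInsdels (κC / 100) (fun x => interleave S (C x)) (dec S))}
      ≤ (2 : ℝ) ^ (-(1 / 100 * κC : ℝ)) := by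
  have := isProbabilityMeasure_runLaw (N := N) ha1
  have hcode : ∀ S : Fin N → ℕ,
      CorrectsInsdels (κC / 100) (fun x => interleave S (C x)) (dec S) →
      IsLinearInsdelCode (blockLength S) (2 * (κC / 100) + 1) (fun x => interleave S (C x)) :=
    fun S h => ⟨exists_linearMap_interleave S C, fun x x' hx => h.le_editDist hx⟩
  rcases subsingleton_or_nontrivial (Fin m → F) with hm | hm
  · -- a single message is always decoded correctly
    have hcorr : ∀ S, CorrectsInsdels (κC / 100) (fun x => interleave S (C x)) (dec S) :=
      fun S x z _ => Subsingleton.elim _ _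
    rw [measureReal_setOf_not_eq_zero fun S => ⟨hcode S (hcorr S), hcorr S⟩]
    positivity
  · obtain ⟨x, x', hx⟩ := exists_pair_ne (Fin m → F)
    have hN : 2 * κC ≤ N := by
      have h1 := hC x x' hx
      have h2 : hammingDist (C x) (C x') ≤ N := by
        simpa using hammingDist_le_card_fintype (x := C x) (y := C x')
      omega
    set t := κC / 100 + 1 with ht
    have hsub : {S | ¬ (IsLinearInsdelCode (blockLength S) (2 * (κC / 100) + 1)
        (fun x => interleave S (C x)) ∧
        CorrectsInsdels (κC / 100) (fun x => interleave S (C x)) (dec S))} ⊆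
        {S : Fin N → ℕ | HasCoincidences S t} := by
      intro S hS
      by_contra hco
      have := correctsInsdels_of_not_hasCoincidences (C := C) hD hco (hdec S)
      exact hS ⟨hcode S this, this⟩
    calc _ ≤ (runLaw N a).real {S | HasCoincidences S t} := measureReal_mono hsub
      _ ≤ _ := runLaw_real_hasCoincidences_le ha1 t
      _ ≤ (2⁻¹ : ℝ) ^ t := choose_pow_four_mul_inv_le hκ hN (by omega) ha
      _ = (2 : ℝ) ^ (-(t : ℝ)) := by
        rw [Real.rpow_neg (by norm_num), Real.rpow_natCast, inv_pow]
      _ ≤ _ := by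
        refine Real.rpow_le_rpow_of_exponent_le (by norm_num) (neg_le_neg ?_)
        have : (κC : ℝ) ≤ 100 * t := by exact_mod_cast (by omega : κC ≤ 100 * t)
        linarith

end InsdelCode

theorem mainTheorem8 :
    ∃ (P : RamProg) (K K₀ : ℕ) (c : ℝ), 0 < c ∧
      ∀ K₁ : ℕ, K₀ ≤ K₁ → ∀ α : ℝ, 0 < α → ∃ c' : ℝ, 0 < c' ∧
        ∀ (F : Type*) [Field F] [Fintype F] [DecidableEq F]
          -- an identification of the field with {0, …, q - 1}
          (label : F ≃ Fin (Fintype.card F)), (label 0 : ℕ) = 0 →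
        ∀ (nC m κC a : ℕ), 1 ≤ κC →
          ((nC : ℝ) / κC) ^ K₀ ≤ a → (a : ℝ) ≤ ((nC : ℝ) / κC) ^ K₁ →
        -- a linear Hamming code with its decoder
        ∀ C : (Fin m → F) →ₗ[F] (Fin nC → F),
          (∀ x x' : Fin m → F, x ≠ x' → 2 * κC + 1 ≤ hammingDist (C x) (C x')) →
        ∀ D : (Fin nC → F) → Fin m → F,
          (∀ (x : Fin m → F) (y : Fin nC → F), hammingDist (C x) y ≤ κC → D y = x) →
        -- a subroutine that computes the Hamming decoder in T steps
        ∀ (A : (ℕ → ℕ) → ℕ → ℕ) (T : ℕ), Implements (fun s => (label s : ℕ)) D A →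
        ∃ dec : (Fin nC → ℕ) → List F → Fin m → F,
          -- decoding: optimal matching, followed by Hamming decoding
          (∀ (S : Fin nC → ℕ) (z : List F),
            (∃ w : List (Fin nC × Fin z.length),
              IsOptimalMatching S z w ∧ dec S z = D (fill z w)) ∧
            DecodesWithin (fun s => (label s : ℕ)) A T P S z (dec S z)
              (K * (blockLength S + z.length + 1) ^ 4 + T)) ∧
          -- failure of error correction
          (runLaw nC a).real {S | ¬ (
              IsLinearInsdelCode (blockLength S) (2 * (κC / 100) + 1)
                (fun x => interleave S (C x)) ∧
              CorrectsInsdels (κC / 100) (fun x => interleave S (C x)) (dec S))}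
            ≤ (2 : ℝ) ^ (-(c * κC)) ∧
          -- failure of error correction or of the length estimate
          (runLaw nC a).real {S | ¬ (
              IsLinearInsdelCode (blockLength S) (2 * (κC / 100) + 1)
                (fun x => interleave S (C x)) ∧
              CorrectsInsdels (κC / 100) (fun x => interleave S (C x)) (dec S) ∧
              (blockLength S : ℝ) ∈ Set.Icc ((1 - α) * nC * (a + 1) / 2 + nC)
                ((1 + α) * nC * (a + 1) / 2 + nC))}
            ≤ (2 : ℝ) ^ (-(c' * κC)) + (2 : ℝ) ^ (-(c * α * a * nC)) := by
  refine ⟨decoderProg, 1000, 45, 1 / 100, by norm_num, fun K₁ hK₁ α hα => ?_⟩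
  obtain ⟨c', hc', hlen⟩ := exists_length_exponent (c := 1 / 100) (by norm_num) K₁ hα
  refine ⟨c', hc', fun F _ _ _ label hlabel0 nC m κC a hκ ha ha' C hC D hD A T hA => ?_⟩
  have hlabel : ∀ s : F, (label s : ℕ) = 0 ↔ s = 0 := fun s =>
    ⟨fun h => label.injective (Fin.ext (h.trans hlabel0.symm)), fun h => h ▸ hlabel0⟩
  have hdec := fun S z => exists_decodesWithin (T := T) hlabel hA (N := nC) S z
  choose w hw hrun using hdec
  have hdec' : ∀ (S : Fin nC → ℕ) (z : List F), ∃ w' : List (Fin nC × Fin z.length),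
      IsOptimalMatching S z w' ∧ D (fill z (w S z)) = D (fill z w') :=
    fun S z => ⟨w S z, hw S z, rfl⟩
  have hκ0 : (1 : ℝ) ≤ κC := by exact_mod_cast hκ
  refine ⟨fun S z => D (fill z (w S z)), fun S z => ⟨hdec' S z, hrun S z⟩, ?_⟩
  rcases Nat.eq_zero_or_pos nC with rfl | hn
  · -- the empty code: there is only one message
    have hm : Subsingleton (Fin m → F) := ⟨fun x x' => by
      by_contra hx
      have h1 := hC x x' hx
      have h2 : hammingDist (C x) (C x') ≤ 0 := by
        simpa using hammingDist_le_card_fintype (x := C x) (y := C x')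
      omega⟩
    have ha0 : a = 0 := by
      have : K₁ ≠ 0 := by omega
      simpa [this] using ha'
    subst ha0
    have hgood : ∀ S : Fin 0 → ℕ,
        IsLinearInsdelCode (blockLength S) (2 * (κC / 100) + 1) (fun x => interleave S (C x)) ∧
        CorrectsInsdels (κC / 100) (fun x => interleave S (C x))
          (fun z => D (fill z (w S z))) := fun S =>
      ⟨⟨exists_linearMap_interleave S C, fun x x' hx => absurd (Subsingleton.elim x x') hx⟩,
        fun x z _ => Subsingleton.elim _ _⟩
    have hlen0 : ∀ S : Fin 0 → ℕ, (blockLength S : ℝ) = 0 := fun S => by simp [blockLength]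
    constructor
    · rw [measureReal_setOf_not_eq_zero hgood]
      positivity
    · rw [measureReal_setOf_not_eq_zero fun S => ⟨(hgood S).1, (hgood S).2, by
        rw [hlen0]; simp⟩]
      positivity
  · have hn0 : (0 : ℝ) < nC := by exact_mod_cast hn
    have ha1 : 1 ≤ a := by
      have : (0 : ℝ) < a := lt_of_lt_of_le (by positivity) ha
      exact_mod_cast this
    have := isProbabilityMeasure_runLaw (N := nC) ha1
    have hfail := runLaw_real_failure_le hκ ha1 ha C hC hD hdec'
    refine ⟨hfail, hlen nC κC a _ hκ ?_ ?_ measureReal_le_one ?_⟩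
    · -- otherwise `a` would lie strictly between `0` and `1`
      by_contra hlt
      have h1 : (nC : ℝ) / κC < 1 := by
        rw [div_lt_one (by linarith)]; exact_mod_cast not_le.1 hlt
      have h2 : ((nC : ℝ) / κC) ^ K₁ < 1 := pow_lt_one₀ (by positivity) h1 (by omega)
      have h3 : (1 : ℝ) ≤ a := by exact_mod_cast ha1
      linarith
    · refine ha'.trans (pow_le_pow_left₀ (by positivity) ?_ _)
      exact div_le_self hn0.le hκ0
    · refine le_trans (measureReal_mono ?_) ((measureReal_union_le _ _).trans
        (add_le_add hfail (runLaw_real_length_le ha1 hα.le)))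
      intro S hS
      by_contra hcon
      rw [Set.mem_union, not_or] at hcon
      have h1 := not_not.1 hcon.1
      exact hS ⟨h1.1, h1.2, not_not.1 hcon.2⟩
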